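/- Model. We work in the word RAM model with word size $w$: in unit time the machine performs arithmetic, bitwise and shift operations on $w$-bit integers, compares, jumps, and reads or writes a memory cell. A memory cell (one word of space) holds either a $w$-bit integer or one point coordinate; coordinates are real numbers that can only be moved, compared and reported. Query programs are fixed finite programs that do not depend on the input, and each query leaves the memory as it was before the query. A point $q\in\mathbb{R}^3$ dominates $p\in\mathbb{R}^3$ if $q.x\ge p.x$, $q.y\ge p.y$ and $q.z\ge p.z$. Write $\lg=\log_2$. Lemma. Let $\varepsilon>0$ be a constant. There are constants $C,\kappa$ and two programs, depending only on $\varepsilon$, such that for all integers $2\le\lambda\le n$, every word size $w\ge\kappa\lg n$ and every set $P$ of $n$ points in $\mathbb{R}^3$, there is a data structure for $P$ that occupies at most $C\,n\log_\lambda n$ words of space, all of whose stored coordinates are coordinates of points of $P$, and such that, for every query point $q\in\mathbb{R}^3$: (i) (dominance counting) the first program computes the number of points of $P$ dominated by $q$ in at most $C\,\lambda\lg n\cdot\log_\lambda n$ time; (ii) (dominance reporting) the second program reports the points of $P$ dominated by $q$, each exactly once, in at most $C\,(\lambda\lg n\cdot\log_\lambda n+k\lg^{\varepsilon}n)$ time,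 where $k$ is the number of reported points. -/

import Mathlib

namespace WordRAM

/-- Points of three-dimensional space. -/
abbrev Point3 : Type := Fin 3 → ℝ

/-- `q` dominates `p` when every coordinate of `q` is at least that of `p`. -/
def Dominates (q p : Point3) : Prop := ∀ i, p i ≤ q i

open Classical in
/-- The points of `P` that lie in the dominance range
`(-∞, q.x] × (-∞, q.y] × (-∞, q.z]`. -/
noncomputable def dominated (P : Finset Point3) (q : Point3) : Finset Point3 :=
  P.filter fun p => Dominates q p

/-! ### The word RAM

The machine has word registers `R₀, R₁, …` that hold `w`-bit integers, coordinate registers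
`X₀, X₁, …` that hold coordinates, and a random access memory each cell of which holds either a
`w`-bit integer or one coordinate. Coordinates are real numbers and are atomic: they can be moved,
compared and reported, but no arithmetic can be done on them. Every instruction takes unit time. -/

/-- The content of one memory cell. -/
inductive Cell : Type
  | word (v : ℕ)
  | coord (x : ℝ)

/-- The arithmetic and bitwise operations on words. -/
inductive BinOp : Type
  | add | sub | mul | div | mod | and | or | xor | shl | shr

/-- Operations on `w`-bit words; all results are taken modulo `2 ^ w`. -/
def BinOp.eval (w : ℕ) : BinOp → ℕ → ℕ → ℕ
  | .add, a, b => (a + b) % 2 ^ w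
  | .sub, a, b => (a + (2 ^ w - b)) % 2 ^ w
  | .mul, a, b => (a * b) % 2 ^ w
  | .div, a, b => (a / b) % 2 ^ w
  | .mod, a, b => (a % b) % 2 ^ w
  | .and, a, b => (a &&& b) % 2 ^ w
  | .or,  a, b => (a ||| b) % 2 ^ w
  | .xor, a, b => (a ^^^ b) % 2 ^ w
  | .shl, a, b => (a <<< b) % 2 ^ w
  | .shr, a, b => (a >>> b) % 2 ^ w

/-- The instructions. Registers are named by fixed indices; memory is addressed by the content of
a word register. -/
inductive Instr : Type
  /-- `R_d := c` -/
  | const (d c : ℕ)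
  /-- `R_d := R_a o R_b` -/
  | op (o : BinOp) (d a b : ℕ)
  /-- `R_d := M[R_a]`, a word -/
  | load (d a : ℕ)
  /-- `M[R_a] := R_b` -/
  | store (a b : ℕ)
  /-- `X_j := M[R_a]`, a coordinate -/
  | loadCoord (j a : ℕ)
  /-- `M[R_a] := X_j` -/
  | storeCoord (a j : ℕ)
  /-- `R_d := 1` if `X_i ≤ X_j`, and `R_d := 0` otherwise -/
  | leCoord (d i j : ℕ)
  /-- jump to instruction `t` if `R_a ≤ R_b` -/
  | jumpLe (a b t : ℕ)
  /-- report the point `(X_i, X_j, X_k)` -/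
  | report (i j k : ℕ)
  /-- stop with result `R_r` -/
  | halt (r : ℕ)

/-- A program is a finite list of instructions. -/
abbrev Program : Type := List Instr

/-- A configuration: program counter, word registers, coordinate registers, memory, and the list
of the points reported so far. -/
structure Config : Type where
  pc : ℕ
  reg : ℕ → ℕ
  xreg : ℕ → ℝ
  mem : List Cell
  out : List Point3

/-- The start of a query with query point `q`: its coordinates are in `X₀, X₁, X₂` (the other
coordinate registers repeat the last one), and the word registers are zero. -/
def Config.start (mem : List Cell) (q : Point3) : Config where
  pc := 0
  reg := fun _ => 0
  xreg := fun j => if j = 0 then q 0 else if j = 1 then q 1 else q 2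
  mem := mem
  out := []

/-- The effect of one instruction. There is no successor after `halt`, after an access outside the
memory, or after loading a cell of the wrong kind. -/
noncomputable def Instr.exec (w : ℕ) (s : Config) : Instr → Option Config
  | .const d c => some { s with pc := s.pc + 1, reg := Function.update s.reg d (c % 2 ^ w) }
  | .op o d a b =>
      some { s with
        pc := s.pc + 1
        reg := Function.update s.reg d (o.eval w (s.reg a) (s.reg b)) }
  | .load d a =>
      match s.mem[s.reg a]? with
      | some (.word v) => some { s with pc := s.pc + 1, reg := Function.update s.reg d v }
      | _ => none
  | .store a b =>
      if s.reg a < s.mem.length then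
        some { s with pc := s.pc + 1, mem := s.mem.set (s.reg a) (.word (s.reg b)) }
      else none
  | .loadCoord j a =>
      match s.mem[s.reg a]? with
      | some (.coord x) => some { s with pc := s.pc + 1, xreg := Function.update s.xreg j x }
      | _ => none
  | .storeCoord a j =>
      if s.reg a < s.mem.length then
        some { s with pc := s.pc + 1, mem := s.mem.set (s.reg a) (.coord (s.xreg j)) }
      else none
  | .leCoord d i j =>
      some { s with
        pc := s.pc + 1
        reg := Function.update s.reg d (if s.xreg i ≤ s.xreg j then 1 % 2 ^ w else 0) }
  | .jumpLe a b t => some { s with pc := if s.reg a ≤ s.reg b then t else s.pc + 1 }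
  | .report i j k =>
      some { s with pc := s.pc + 1, out := s.out ++ [![s.xreg i, s.xreg j, s.xreg k]] }
  | .halt _ => none

/-- One step of the program. -/
noncomputable def step (w : ℕ) (prog : Program) (s : Config) : Option Config :=
  match prog[s.pc]? with
  | some i => i.exec w s
  | none => none

/-- The configuration after exactly `t` steps, if there is one. -/
noncomputable def run (w : ℕ) (prog : Program) : ℕ → Config → Option Config
  | 0, s => some s
  | t + 1, s => (step w prog s).bind (run w prog t)

/-- Started on the data structure `mem` and the query point `q`, the program halts after at most
`T` instructions (the final `halt` included), with the memory in its original state, so that the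
data structure can serve further queries, and with a result and a list of reported points that
satisfy `post`. -/
def HaltsWithin (w : ℕ) (prog : Program) (mem : List Cell) (q : Point3) (T : ℝ)
    (post : ℕ → List Point3 → Prop) : Prop :=
  ∃ (t r : ℕ) (s : Config), ((t + 1 : ℕ) : ℝ) ≤ T ∧
    run w prog t (Config.start mem q) = some s ∧
    prog[s.pc]? = some (Instr.halt r) ∧ s.mem = mem ∧ post (s.reg r) s.out

/-- `mem` is a legal memory for a data structure over `P` with word size `w`: every word has `w`
bits, and every stored coordinate is a coordinate of a point of `P`. -/
def IsMemoryFor (w : ℕ) (P : Finset Point3) (mem : List Cell) : Prop :=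
  (∀ v, Cell.word v ∈ mem → v < 2 ^ w) ∧
    (∀ x, Cell.coord x ∈ mem → ∃ p ∈ P, ∃ i, x = p i)

end WordRAM

/-! Sort the points by the third coordinate and put them into a tree of degree `lam`, with at most
`lam ^ d` points in a subtree of height `d`. At each node on the search path, the children entirely
below `q` in the third coordinate form an initial run, and at most one further child has to be
entered. A query thus splits into about `lam * clog lam n` queries in the first two coordinates
(`built_tree`). Each point occurs in `O(clog lam n)` of the two-dimensional structures, so it
suffices that these have linear size and answer in `O(lg n)` time, plus `O(1)` per reported point.

For counting (`built_countXY`), a binary search (`built_search`) finds the rank of `q 1` among the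
points sorted by the second coordinate. A wavelet tree (`built_wavelet`) then counts the points of
that prefix with a small first coordinate. Its `lg n` levels of bit vectors are packed about `lg n`
bits to a word, which makes the size linear; ranks inside a word come from a table with at most `n`
entries. For reporting (`built_reportXY`), a priority search tree is used: a heap on the second
coordinate, split by the first. It spends constant time per reported point, so the factor `lg ^ ε`
in the bound is not needed.

Query programs must not depend on the input. The data structure is therefore itself code for a small
abstract machine, and the two programs are one fixed interpreter with two entry points. It spends at
most 60 instructions per abstract step (`Step.sim`), so everything else can be proved about the
abstract machine. -/

namespace WordRAM

/-! ### An abstract machine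

The data structure is a list of `Node`s, the instructions of an abstract machine that has a
position `p` in a rank structure, an accumulator and an output list. -/

/-- The records of the data structure. -/
inductive Node : Type
  | halt
  /-- set the position to `v` -/
  | setPos (v next : ℕ)
  /-- add the position to the accumulator -/
  | addPos (next : ℕ)
  /-- compare `c` with coordinate `ax` of the query point -/
  | cmp (ax : Fin 3) (c : ℝ) (yes no : ℕ)
  /-- a node of a wavelet tree: `r` is the rank of the position, read off from the blocks at `base`
  with `B` bits each; depending on the comparison of `c` with the first coordinate of the query
  point, add `r` to the accumulator and continue with the remaining part of the position, or
  continue with `r` -/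
  | rank (c : ℝ) (B base yes no : ℕ)
  /-- report a point -/
  | report (pt : Point3) (next : ℕ)
  /-- a block of a bit vector: the number of ones before the block, and its bits -/
  | block (pre bits : ℕ)
  /-- an entry of the table of bit counts -/
  | pop (v : ℕ)

/-- The state of the abstract machine. -/
structure St : Type where
  p : ℕ
  acc : ℕ
  out : List Point3

/-- A step of the abstract machine. -/
inductive Step (code : List Node) (q : Point3) : ℕ → St → ℕ → St → Prop
  | setPos {i v k s} : code[i]? = some (.setPos v k) → Step code q i s k { s with p := v }
  | addPos {i k s} : code[i]? = some (.addPos k) →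
      Step code q i s k { s with acc := s.acc + s.p }
  | cmpYes {i ax c yes no s} : code[i]? = some (.cmp ax c yes no) → c ≤ q ax →
      Step code q i s yes s
  | cmpNo {i ax c yes no s} : code[i]? = some (.cmp ax c yes no) → ¬ c ≤ q ax →
      Step code q i s no s
  | rankYes {i c B base yes no pre bits v s} : code[i]? = some (.rank c B base yes no) →
      code[base + s.p / B]? = some (.block pre bits) →
      code[bits % 2 ^ (s.p % B)]? = some (.pop v) → pre + v ≤ s.p → c ≤ q 0 →
      Step code q i s yes { s with p := s.p - (pre + v), acc := s.acc + (pre + v) }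
  | rankNo {i c B base yes no pre bits v s} : code[i]? = some (.rank c B base yes no) →
      code[base + s.p / B]? = some (.block pre bits) →
      code[bits % 2 ^ (s.p % B)]? = some (.pop v) → pre + v ≤ s.p → ¬ c ≤ q 0 →
      Step code q i s no { s with p := pre + v }
  | report {i pt k s} : code[i]? = some (.report pt k) →
      Step code q i s k { s with out := s.out ++ [pt] }

/-- The abstract machine gets from one configuration to another in exactly `t` steps. -/
inductive Reach (code : List Node) (q : Point3) : ℕ → ℕ → St → ℕ → St → Prop
  | refl {i s} : Reach code q 0 i s i s
  | head {t i s j s' k s''} : Step code q i s j s' → Reach code q t j s' k s'' →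
      Reach code q (t + 1) i s k s''

theorem Reach.trans {code : List Node} {q : Point3} {t t' i j k : ℕ} {s s' s'' : St}
    (h : Reach code q t i s j s') (h' : Reach code q t' j s' k s'') :
    Reach code q (t + t') i s k s'' := by
  induction h with
  | refl => simpa using h'
  | head h1 _ ih => rw [Nat.add_right_comm]; exact .head h1 (ih h')

/-! ### Encoding in memory -/

/-- The address of the record with a given number. -/
def addr (i : ℕ) : ℕ := 6 * i + 2

/-- The memory cells of a record. -/
def Node.enc : Node → List Cell
  | .halt => [.word 0, .word 0, .word 0, .word 0, .word 0, .word 0]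
  | .setPos v k => [.word 1, .word v, .word (addr k), .word 0, .word 0, .word 0]
  | .addPos k => [.word 2, .word (addr k), .word 0, .word 0, .word 0, .word 0]
  | .cmp ax c y n =>
      [.word (3 + ax), .coord c, .word (addr y), .word (addr n), .word 0, .word 0]
  | .rank c B b y n =>
      [.word 6, .coord c, .word B, .word (addr b), .word (addr y), .word (addr n)]
  | .report pt k =>
      [.word 7, .coord (pt 0), .coord (pt 1), .coord (pt 2), .word (addr k), .word 0]
  | .block pre bits => [.word pre, .word bits, .word 0, .word 0, .word 0, .word 0]
  | .pop v => [.word v, .word 0, .word 0, .word 0, .word 0, .word 0]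

theorem Node.length_enc (nd : Node) : nd.enc.length = 6 := by cases nd <;> rfl

/-- The memory with two given entry points. -/
def memOf (code : List Node) (a b : ℕ) : List Cell :=
  .word (addr a) :: .word (addr b) :: code.flatMap Node.enc

theorem length_memOf (code : List Node) (a b : ℕ) :
    (memOf code a b).length = 6 * code.length + 2 := by
  have : (code.flatMap Node.enc).length = 6 * code.length := by
    induction code with
    | nil => rfl
    | cons x l ih => simp [Node.length_enc, ih]; ring
  simp [memOf, this]

theorem flatMap_enc_getElem? (code : List Node) (i j : ℕ) (nd : Node) (h : code[i]? = some nd)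
    (hj : j < 6) : (code.flatMap Node.enc)[6 * i + j]? = nd.enc[j]? := by
  induction code generalizing i with
  | nil => simp at h
  | cons x l ih =>
    rw [List.flatMap_cons]
    cases i with
    | zero =>
      simp only [List.getElem?_cons_zero, Option.some.injEq] at h
      subst h
      rw [List.getElem?_append_left (by rw [Node.length_enc]; omega)]
      simp
    | succ i =>
      rw [List.getElem?_append_right (by rw [Node.length_enc]; omega), Node.length_enc,
        show 6 * (i + 1) + j - 6 = 6 * i + j by omega]
      exact ih i (by simpa using h)

theorem memOf_getElem? {code : List Node} {i : ℕ} {nd : Node} (a b j : ℕ)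
    (h : code[i]? = some nd) (hj : j < 6) :
    (memOf code a b)[addr i + j]? = nd.enc[j]? := by
  rw [← flatMap_enc_getElem? code i j nd h hj, memOf, show addr i + j = 6 * i + j + 1 + 1 by
    simp only [addr]; omega, List.getElem?_cons_succ, List.getElem?_cons_succ]

/-- `c` is a coordinate of a point of `P`. -/
def IsCoordOf (P : Finset Point3) (c : ℝ) : Prop := ∃ p ∈ P, ∃ i, c = p i

/-- The numbers and addresses of a record are bounded by `n` and `L`, and its coordinates stem from
the points of `P`. -/
def Node.Ok (P : Finset Point3) (n L : ℕ) : Node → Prop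
  | .halt => True
  | .setPos v k => v ≤ n ∧ k < L
  | .addPos k => k < L
  | .cmp _ c y no => IsCoordOf P c ∧ y < L ∧ no < L
  | .rank c B b y no => IsCoordOf P c ∧ 0 < B ∧ 2 ^ B ≤ n ∧ b < L ∧ y < L ∧ no < L
  | .report pt k => pt ∈ P ∧ k < L
  | .block pre bits => pre ≤ n ∧ bits ≤ n
  | .pop v => v ≤ n

theorem Node.Ok.mono {P : Finset Point3} {n L L' : ℕ} {nd : Node} (h : nd.Ok P n L)
    (hL : L ≤ L') : nd.Ok P n L' := by
  cases nd <;> simp only [Node.Ok] at h ⊢ <;> grind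

/-- All records of a list are correct. -/
def Valid (P : Finset Point3) (n : ℕ) (code : List Node) : Prop :=
  ∀ nd ∈ code, nd.Ok P n code.length

theorem isMemoryFor_memOf {w n : ℕ} {P : Finset Point3} {code : List Node} {a b : ℕ}
    (hv : Valid P n code) (ha : a < code.length) (hb : b < code.length)
    (hw : 6 * code.length + n + 8 ≤ 2 ^ w) : IsMemoryFor w P (memOf code a b) := by
  constructor
  · intro v hvm
    simp only [memOf, List.mem_cons, List.mem_flatMap, Cell.word.injEq] at hvm
    rcases hvm with rfl | rfl | ⟨nd, hnd, hvm⟩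
    · simp only [addr]; omega
    · simp only [addr]; omega
    · have hok := hv nd hnd
      cases nd with
      | rank c B b y no =>
        -- The block length is itself stored as a word; it is bounded by `B < 2 ^ B ≤ n`.
        have := B.lt_two_pow_self
        simp [Node.enc, Node.Ok, addr] at hok hvm; omega
      | cmp ax c y no =>
        have := ax.isLt
        simp [Node.enc, Node.Ok, addr] at hok hvm; omega
      | _ => simp [Node.enc, Node.Ok, addr] at hok hvm; omega
  · intro x hx
    simp only [memOf, List.mem_cons, List.mem_flatMap, reduceCtorEq, false_or] at hx
    obtain ⟨nd, hnd, hx⟩ := hx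
    have hok := hv nd hnd
    cases nd <;> simp [Node.enc, Node.Ok] at hok hx
    · subst hx; exact hok.1
    · subst hx; exact hok.1
    · rcases hx with rfl | rfl | rfl <;> exact ⟨_, hok.1, _, rfl⟩

/-! ### The interpreter -/

/-- The interpreter of the abstract machine, started at entry point `e`. Register `0` holds the
address of the current record, `1` the position, `2` the accumulator. -/
def interp (e : ℕ) : Program :=
  [ .const 0 e,
    .load 0 0,
    -- 2: fetch
    .load 3 0,
    .const 4 1,
    .op .add 0 0 4,
    .const 5 0,
    .jumpLe 3 5 21,
    .op .add 5 5 4,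
    .jumpLe 3 5 22,
    .op .add 5 5 4,
    .jumpLe 3 5 26,
    .op .add 5 5 4,
    .jumpLe 3 5 29,
    .op .add 5 5 4,
    .jumpLe 3 5 36,
    .op .add 5 5 4,
    .jumpLe 3 5 43,
    .op .add 5 5 4,
    .jumpLe 3 5 50,
    -- Comparing a register with itself gives an unconditional jump. Opcode 7 is what remains here,
    -- so the next instruction is never reached.
    .jumpLe 0 0 81,
    .halt 2,
    -- 21: halt
    .halt 2,
    -- 22: set the position
    .load 1 0,
    .op .add 0 0 4,
    .load 0 0,
    .jumpLe 0 0 2,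
    -- 26: add the position
    .op .add 2 2 1,
    .load 0 0,
    .jumpLe 0 0 2,
    -- 29, 36, 43: compare
    .loadCoord 3 0,
    .op .add 0 0 4,
    .leCoord 5 3 0,
    .jumpLe 4 5 34,
    .op .add 0 0 4,
    .load 0 0,
    .jumpLe 0 0 2,
    .loadCoord 3 0,
    .op .add 0 0 4,
    .leCoord 5 3 1,
    .jumpLe 4 5 41,
    .op .add 0 0 4,
    .load 0 0,
    .jumpLe 0 0 2,
    .loadCoord 3 0,
    .op .add 0 0 4,
    .leCoord 5 3 2,
    .jumpLe 4 5 48,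
    .op .add 0 0 4,
    .load 0 0,
    .jumpLe 0 0 2,
    -- 50: rank
    .loadCoord 3 0,
    .op .add 0 0 4,
    .load 5 0,
    .op .add 0 0 4,
    .load 6 0,
    .op .add 0 0 4,
    .op .div 7 1 5,
    .op .mod 8 1 5,
    .const 9 6,
    .op .mul 7 7 9,
    .op .add 6 6 7,
    .load 7 6,
    .op .add 6 6 4,
    .load 10 6,
    .op .shl 8 4 8,
    .op .mod 10 10 8,
    .op .mul 10 10 9,
    .const 11 2,
    .op .add 10 10 11,
    .load 10 10,
    .op .add 7 7 10,
    .leCoord 5 3 0,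
    .jumpLe 4 5 77,
    .op .add 0 0 4,
    -- A bitwise or of a register with itself serves as a move.
    .op .or 1 7 7,
    .load 0 0,
    .jumpLe 0 0 2,
    -- 77
    .op .add 2 2 7,
    .op .sub 1 1 7,
    .load 0 0,
    .jumpLe 0 0 2,
    -- 81: report
    .loadCoord 3 0,
    .op .add 0 0 4,
    .loadCoord 4 0,
    .op .add 0 0 4,
    .loadCoord 5 0,
    .op .add 0 0 4,
    .report 3 4 5,
    .load 0 0,
    .jumpLe 0 0 2 ]

theorem run_add (w : ℕ) (prog : Program) (t t' : ℕ) (s : Config) :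
    run w prog (t + t') s = (run w prog t s).bind (run w prog t') := by
  induction t generalizing s with
  | zero => simp [run]
  | succ t ih =>
    rw [Nat.add_right_comm, run, run, Option.bind_assoc]
    congr 1
    funext s'
    exact ih s'

/-- Within `n` steps, the program gets from `c` to a configuration that satisfies `Q`. -/
def Runs (w : ℕ) (prog : Program) (n : ℕ) (c : Config) (Q : Config → Prop) : Prop :=
  ∃ t ≤ n, ∃ c', run w prog t c = some c' ∧ Q c'

section Runs

variable {w n pc : ℕ} {prog : Program} {reg : ℕ → ℕ} {xreg : ℕ → ℝ} {mem : List Cell}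
  {out : List Point3} {Q : Config → Prop}

theorem Runs.done {c : Config} (h : Q c) : Runs w prog n c Q :=
  ⟨0, Nat.zero_le _, c, rfl, h⟩

theorem Runs.trans {m : ℕ} {c : Config} {Q' : Config → Prop} (h : Runs w prog m c Q')
    (h' : ∀ c', Q' c' → Runs w prog n c' Q) : Runs w prog (m + n) c Q := by
  obtain ⟨t, ht, c', hr, hq⟩ := h
  obtain ⟨t', ht', c'', hr', hq'⟩ := h' c' hq
  exact ⟨t + t', by omega, c'', by rw [run_add, hr, Option.bind_some, hr'], hq'⟩

theorem Runs.cons {i : Instr} {c c' : Config} (hi : prog[c.pc]? = some i)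
    (he : i.exec w c = some c') (h : Runs w prog n c' Q) : Runs w prog (n + 1) c Q := by
  obtain ⟨t, ht, c'', hr, hq⟩ := h
  refine ⟨t + 1, by omega, c'', ?_, hq⟩
  rw [run, step, hi]
  simp [he, hr]

/-- Rules for symbolic execution, one per kind of instruction used. The new value is a parameter
with its own equation, so configurations stay in evaluated form along a run. -/
theorem Runs.const {d k v : ℕ} (hi : prog[pc]? = some (.const d k)) (hv : k % 2 ^ w = v)
    (h : Runs w prog n ⟨pc + 1, Function.update reg d v, xreg, mem, out⟩ Q) :
    Runs w prog (n + 1) ⟨pc, reg, xreg, mem, out⟩ Q :=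
  .cons hi (by rw [Instr.exec, hv]) h

theorem Runs.op {o : BinOp} {d a b v : ℕ} (hi : prog[pc]? = some (.op o d a b))
    (hv : o.eval w (reg a) (reg b) = v)
    (h : Runs w prog n ⟨pc + 1, Function.update reg d v, xreg, mem, out⟩ Q) :
    Runs w prog (n + 1) ⟨pc, reg, xreg, mem, out⟩ Q :=
  .cons hi (by rw [Instr.exec, hv]) h

theorem Runs.load {d a v : ℕ} (hi : prog[pc]? = some (.load d a))
    (hv : mem[reg a]? = some (.word v))
    (h : Runs w prog n ⟨pc + 1, Function.update reg d v, xreg, mem, out⟩ Q) :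
    Runs w prog (n + 1) ⟨pc, reg, xreg, mem, out⟩ Q :=
  .cons hi (by simp [Instr.exec, hv]) h

theorem Runs.loadCoord {j a : ℕ} {x : ℝ} (hi : prog[pc]? = some (.loadCoord j a))
    (hx : mem[reg a]? = some (.coord x))
    (h : Runs w prog n ⟨pc + 1, reg, Function.update xreg j x, mem, out⟩ Q) :
    Runs w prog (n + 1) ⟨pc, reg, xreg, mem, out⟩ Q :=
  .cons hi (by simp [Instr.exec, hx]) h

theorem Runs.leCoord {d i j v : ℕ} (hi : prog[pc]? = some (.leCoord d i j))
    (hv : (if xreg i ≤ xreg j then 1 % 2 ^ w else 0) = v)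
    (h : Runs w prog n ⟨pc + 1, Function.update reg d v, xreg, mem, out⟩ Q) :
    Runs w prog (n + 1) ⟨pc, reg, xreg, mem, out⟩ Q :=
  .cons hi (by rw [Instr.exec, hv]) h

theorem Runs.jump {a b t : ℕ} (hi : prog[pc]? = some (.jumpLe a b t)) (hab : reg a ≤ reg b)
    (h : Runs w prog n ⟨t, reg, xreg, mem, out⟩ Q) :
    Runs w prog (n + 1) ⟨pc, reg, xreg, mem, out⟩ Q :=
  .cons hi (by simp [Instr.exec, hab]) h

theorem Runs.skip {a b t : ℕ} (hi : prog[pc]? = some (.jumpLe a b t)) (hab : ¬ reg a ≤ reg b)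
    (h : Runs w prog n ⟨pc + 1, reg, xreg, mem, out⟩ Q) :
    Runs w prog (n + 1) ⟨pc, reg, xreg, mem, out⟩ Q :=
  .cons hi (by simp [Instr.exec, hab]) h

theorem Runs.report {i j k : ℕ} (hi : prog[pc]? = some (.report i j k))
    (h : Runs w prog n ⟨pc + 1, reg, xreg, mem, out ++ [![xreg i, xreg j, xreg k]]⟩ Q) :
    Runs w prog (n + 1) ⟨pc, reg, xreg, mem, out⟩ Q :=
  .cons hi rfl h

end Runs

/-- The interpreter represents a configuration of the abstract machine. -/
structure Sim (w : ℕ) (mem : List Cell) (q : Point3) (i : ℕ) (s : St) (c : Config) : Prop where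
  pc : c.pc = 2
  cur : c.reg 0 = addr i
  pos : c.reg 1 = s.p
  pos_lt : s.p < 2 ^ w
  -- The accumulator is tracked only modulo `2 ^ w`, so no bound on it is needed during a run. The
  -- position must be exact, since it is divided.
  acc : c.reg 2 = s.acc % 2 ^ w
  x0 : c.xreg 0 = q 0
  x1 : c.xreg 1 = q 1
  x2 : c.xreg 2 = q 2
  mem : c.mem = mem
  out : c.out = s.out

/-- The program counter at which the interpreter handles the records with opcode `o`. -/
def entry : ℕ → ℕ
  | 0 => 21
  | 1 => 22
  | 2 => 26
  | 3 => 29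
  | 4 => 36
  | 5 => 43
  | 6 => 50
  | _ => 81

/-- Register 5 counts upwards until it reaches the opcode. The longest path, for opcode 7, has 4 +
14 = 18 instructions. -/
theorem runs_dispatch {w e a o : ℕ} {reg : ℕ → ℕ} {xreg : ℕ → ℝ} {mem : List Cell}
    {out : List Point3} (hr : reg 0 = a) (hm : mem[a]? = some (.word o)) (ho : o < 8)
    (ha : a + 8 < 2 ^ w) :
    Runs w (interp e) 18 ⟨2, reg, xreg, mem, out⟩ fun c => ∃ reg',
      c = ⟨entry o, reg', xreg, mem, out⟩ ∧
      reg' 0 = a + 1 ∧ reg' 1 = reg 1 ∧ reg' 2 = reg 2 ∧ reg' 4 = 1 := by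
  have hmod : ∀ x ≤ a + 8, x % 2 ^ w = x := fun x hx => Nat.mod_eq_of_lt (by omega)
  refine .load rfl (v := o) (by simp [hr, hm]) ?_
  refine .const rfl (v := 1) (hmod _ (by omega)) ?_
  refine .op rfl (v := a + 1) (by simp [BinOp.eval, hr, hmod]) ?_
  refine .const rfl (v := 0) (by simp) ?_
  rcases Nat.eq_zero_or_pos o with rfl | h0
  · exact .jump rfl (by simp) (.done ⟨_, rfl, by simp⟩)
  refine .skip rfl (by simpa using Nat.ne_of_gt h0) ?_
  refine .op rfl (v := 1) (by simp [BinOp.eval, hmod]) ?_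
  rcases Nat.eq_or_lt_of_le h0 with rfl | h0
  · exact .jump rfl (by simp) (.done ⟨_, rfl, by simp⟩)
  refine .skip rfl (by simpa using h0) ?_
  refine .op rfl (v := 2) (by simp [BinOp.eval, hmod]) ?_
  rcases Nat.eq_or_lt_of_le h0 with rfl | h0
  · exact .jump rfl (by simp) (.done ⟨_, rfl, by simp⟩)
  refine .skip rfl (by simpa using h0) ?_
  refine .op rfl (v := 3) (by simp [BinOp.eval, hmod]) ?_
  rcases Nat.eq_or_lt_of_le h0 with rfl | h0
  · exact .jump rfl (by simp) (.done ⟨_, rfl, by simp⟩)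
  refine .skip rfl (by simpa using h0) ?_
  refine .op rfl (v := 4) (by simp [BinOp.eval, hmod]) ?_
  rcases Nat.eq_or_lt_of_le h0 with rfl | h0
  · exact .jump rfl (by simp) (.done ⟨_, rfl, by simp⟩)
  refine .skip rfl (by simpa using h0) ?_
  refine .op rfl (v := 5) (by simp [BinOp.eval, hmod]) ?_
  rcases Nat.eq_or_lt_of_le h0 with rfl | h0
  · exact .jump rfl (by simp) (.done ⟨_, rfl, by simp⟩)
  refine .skip rfl (by simpa using h0) ?_
  refine .op rfl (v := 6) (by simp [BinOp.eval, hmod]) ?_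
  rcases Nat.eq_or_lt_of_le h0 with rfl | h0
  · exact .jump rfl (by simp) (.done ⟨_, rfl, by simp⟩)
  refine .skip rfl (by simpa using h0) ?_
  obtain rfl : o = 7 := by omega
  exact .jump rfl (by simp) (.done ⟨_, rfl, by simp⟩)

/-- The interpreter simulates a step of the abstract machine in constant time. -/
theorem Step.sim {w n e i j a b : ℕ} {P : Finset Point3} {code : List Node} {q : Point3}
    {s s' : St} {c : Config} (hw : 6 * code.length + n + 16 ≤ 2 ^ w) (hv : Valid P n code)
    (h : Step code q i s j s') (hc : Sim w (memOf code a b) q i s c) :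
    Runs w (interp e) 60 c (Sim w (memOf code a b) q j s') := by
  obtain ⟨pc, reg, xreg, mem, out⟩ := c
  obtain ⟨rfl, hr0, hr1, hlt, hr2, hx0, hx1, hx2, rfl, rfl⟩ := hc
  simp only at hr0 hr1 hr2 hx0 hx1 hx2
  have lt_len : ∀ {k : ℕ} {nd : Node}, code[k]? = some nd → k < code.length := fun h =>
    (List.getElem?_eq_some_iff.1 h).1
  have hok : ∀ {k : ℕ} {nd : Node}, code[k]? = some nd → nd.Ok P n code.length := fun h =>
    hv _ (List.mem_of_getElem? h)
  have cell := @memOf_getElem? code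
  generalize hM : memOf code a b = M at *
  -- Fetch and dispatch use at most 18 of the 60 instructions and leave 42 for the record itself.
  have start : ∀ {nd : Node} {o : ℕ} {Q : Config → Prop}, code[i]? = some nd → o < 8 →
      nd.enc[0]? = some (.word o) →
      (∀ reg' : ℕ → ℕ, reg' 0 = addr i + 1 → reg' 1 = s.p → reg' 2 = s.acc % 2 ^ w →
        reg' 4 = 1 → Runs w (interp e) 42 ⟨entry o, reg', xreg, M, s.out⟩ Q) →
      Runs w (interp e) 60 ⟨2, reg, xreg, M, s.out⟩ Q := by
    intro nd o Q hnd ho henc hQ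
    have hi := lt_len hnd
    have hm : M[addr i]? = some (.word o) := by
      rw [← henc, ← cell a b 0 hnd (by omega), hM]; rfl
    refine (runs_dispatch hr0 hm ho (by simp only [addr]; omega)).trans (n := 42) ?_
    rintro _ ⟨reg', rfl, h0, h1, h2, h4⟩
    exact hQ reg' h0 (h1.trans hr1) (h2.trans hr2) h4
  have field : ∀ {k : ℕ} {nd : Node} (f : ℕ), code[k]? = some nd → f < 6 →
      M[addr k + f]? = nd.enc[f]? := fun f h hf => hM ▸ cell a b f h hf
  clear cell hM hr0 hr1 hr2
  have hmod : ∀ x ≤ addr i + 8, i < code.length → x % 2 ^ w = x := fun x hx hi =>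
    Nat.mod_eq_of_lt (by simp only [addr] at hx; omega)
  -- Both outcomes of a rank record share the 21 instructions that compute the rank, which leaves 21
  -- for the branch.
  have rank : ∀ {x : ℝ} {B base y no pre bits v : ℕ} {Q : Config → Prop},
      code[i]? = some (.rank x B base y no) → code[base + s.p / B]? = some (.block pre bits) →
      code[bits % 2 ^ (s.p % B)]? = some (.pop v) → pre + v ≤ s.p →
      (∀ reg' : ℕ → ℕ, reg' 0 = addr i + 4 → reg' 1 = s.p → reg' 2 = s.acc % 2 ^ w →
        reg' 4 = 1 → reg' 7 = pre + v →
        Runs w (interp e) 21 ⟨71, reg', Function.update xreg 3 x, M, s.out⟩ Q) →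
      Runs w (interp e) 60 ⟨2, reg, xreg, M, s.out⟩ Q := by
    intro x B base y no pre bits v Q h hb hp hle hQ
    have hi := lt_len h
    have hbl := lt_len hb
    have hpl := lt_len hp
    obtain ⟨-, hB, hBn, -⟩ := hok h
    have hsmall : ∀ z ≤ 6 * code.length + n + 8, z % 2 ^ w = z := fun z hz =>
      Nat.mod_eq_of_lt (by omega)
    have hpow : 2 ^ (s.p % B) ≤ n :=
      (Nat.pow_le_pow_right (by omega) (Nat.mod_lt _ hB).le).trans hBn
    have hdiv : s.p / B < code.length := by omega
    have hBle : B ≤ n := B.lt_two_pow_self.le.trans hBn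
    have hmodB : s.p % B ≤ n := (Nat.mod_lt _ hB).le.trans hBle
    refine start h (o := 6) (by omega) rfl fun r h0 h1 h2 h4 => ?_
    refine .loadCoord rfl (x := x) (by rw [h0, field 1 h (by omega)]; rfl) ?_
    refine .op rfl (v := addr i + 2) (by simp [BinOp.eval, h0, h4, hmod, hi]) ?_
    refine .load rfl (v := B) (by simp [field 2 h, Node.enc]) ?_
    refine .op rfl (v := addr i + 3) (by simp [BinOp.eval, h4, hmod, hi]) ?_
    refine .load rfl (v := addr base) (by simp [field 3 h, Node.enc]) ?_
    refine .op rfl (v := addr i + 4) (by simp [BinOp.eval, h4, hmod, hi]) ?_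
    refine .op rfl (v := s.p / B) ?_ ?_
    · simpa [BinOp.eval, h1] using hsmall _ (by omega)
    refine .op rfl (v := s.p % B) ?_ ?_
    · simpa [BinOp.eval, h1] using hsmall _ (by omega)
    refine .const rfl (v := 6) (hsmall _ (by omega)) ?_
    refine .op rfl (v := s.p / B * 6) ?_ ?_
    · simpa [BinOp.eval] using hsmall _ (by omega)
    refine .op rfl (v := addr (base + s.p / B)) ?_ ?_
    · simp only [BinOp.eval]
      simp [addr]
      rw [hsmall] <;> omega
    refine .load rfl (v := pre) ?_ ?_
    · simpa [Node.enc] using field 0 hb (by omega)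
    refine .op rfl (v := addr (base + s.p / B) + 1) ?_ ?_
    · simpa [BinOp.eval, h4] using hsmall _ (by simp only [addr]; omega)
    refine .load rfl (v := bits) ?_ ?_
    · simpa [Node.enc] using field 1 hb (by omega)
    refine .op rfl (v := 2 ^ (s.p % B)) ?_ ?_
    · simpa [BinOp.eval, h4, Nat.shiftLeft_eq] using hsmall _ (by omega)
    refine .op rfl (v := bits % 2 ^ (s.p % B)) ?_ ?_
    · simpa [BinOp.eval] using hsmall _ (by omega)
    refine .op rfl (v := bits % 2 ^ (s.p % B) * 6) ?_ ?_
    · simpa [BinOp.eval] using hsmall _ (by omega)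
    refine .const rfl (v := 2) (hsmall _ (by omega)) ?_
    -- The table of bit counts starts at record 0, so the masked block is the number of its table
    -- entry.
    refine .op rfl (v := addr (bits % 2 ^ (s.p % B))) ?_ ?_
    · simp [BinOp.eval, addr]
      rw [hsmall] <;> omega
    refine .load rfl (v := v) ?_ ?_
    · simpa [Node.enc] using field 0 hp (by omega)
    refine .op rfl (v := pre + v) ?_ ?_
    · simpa [BinOp.eval] using Nat.mod_eq_of_lt (by omega)
    refine hQ _ ?_ ?_ ?_ ?_ ?_ <;> simp [h1, h2, h4]
  cases h with
  | @setPos v _ _ h =>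
    have hi := lt_len h
    refine start h (o := 1) (by omega) rfl fun r h0 h1 h2 h4 => ?_
    refine .load rfl (v := v) (by rw [h0, field 1 h (by omega)]; rfl) ?_
    refine .op rfl (v := addr i + 2) (by simp [BinOp.eval, h0, h4, hmod, hi]) ?_
    refine .load rfl (v := addr j) (by simp [field 2 h, Node.enc]) ?_
    refine .jump rfl le_rfl (.done ?_)
    have := (hok h).1
    constructor <;> simp [h2, hx0, hx1, hx2]
    omega
  | addPos h =>
    have hi := lt_len h
    refine start h (o := 2) (by omega) rfl fun r h0 h1 h2 h4 => ?_
    refine .op rfl (v := (s.acc + s.p) % 2 ^ w) (by simp [BinOp.eval, h1, h2]) ?_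
    refine .load rfl (v := addr j) (by simp [h0, field 1 h, Node.enc]) ?_
    refine .jump rfl le_rfl (.done ?_)
    constructor <;> simp [h1, hx0, hx1, hx2, hlt]
  | @report pt _ _ h =>
    have hi := lt_len h
    refine start h (o := 7) (by omega) rfl fun r h0 h1 h2 h4 => ?_
    refine .loadCoord rfl (x := pt 0) (by rw [h0, field 1 h (by omega)]; rfl) ?_
    refine .op rfl (v := addr i + 2) (by simp [BinOp.eval, h0, h4, hmod, hi]) ?_
    refine .loadCoord rfl (x := pt 1) (by simp [field 2 h, Node.enc]) ?_
    refine .op rfl (v := addr i + 3) (by simp [BinOp.eval, h4, hmod, hi]) ?_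
    refine .loadCoord rfl (x := pt 2) (by simp [field 3 h, Node.enc]) ?_
    refine .op rfl (v := addr i + 4) (by simp [BinOp.eval, h4, hmod, hi]) ?_
    refine .report rfl ?_
    refine .load rfl (v := addr j) (by simp [field 4 h, Node.enc]) ?_
    refine .jump rfl le_rfl (.done ?_)
    have hpt : ![pt 0, pt 1, pt 2] = pt := by
      funext t; fin_cases t <;> rfl
    constructor <;> simp [hpt, h1, h2, hx0, hx1, hx2, hlt]
  | @cmpYes ax x y no _ h hx =>
    have hi := lt_len h
    fin_cases ax <;>
    · refine start h (o := _) (by simp) rfl fun r h0 h1 h2 h4 => ?_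
      refine .loadCoord rfl (x := x) (by rw [h0, field 1 h (by omega)]; rfl) ?_
      refine .op rfl (v := addr i + 2) (by simp [BinOp.eval, h0, h4, hmod, hi]) ?_
      refine .leCoord rfl (v := 1) ?_ ?_
      · rw [if_pos (by simpa [hx0, hx1, hx2] using hx), hmod 1 (by omega) hi]
      refine .jump rfl (by simp [h4]) ?_
      refine .load rfl (v := addr j) (by simp [field 2 h, Node.enc]) ?_
      refine .jump rfl le_rfl (.done ?_)
      constructor <;> simp [h1, h2, hx0, hx1, hx2, hlt]
  | @cmpNo ax x y no _ h hx =>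
    have hi := lt_len h
    fin_cases ax <;>
    · refine start h (o := _) (by simp) rfl fun r h0 h1 h2 h4 => ?_
      refine .loadCoord rfl (x := x) (by rw [h0, field 1 h (by omega)]; rfl) ?_
      refine .op rfl (v := addr i + 2) (by simp [BinOp.eval, h0, h4, hmod, hi]) ?_
      refine .leCoord rfl (v := 0) (if_neg (by simpa [hx0, hx1, hx2] using hx)) ?_
      refine .skip rfl (by simp [h4]) ?_
      refine .op rfl (v := addr i + 3) (by simp [BinOp.eval, h4, hmod, hi]) ?_
      refine .load rfl (v := addr j) (by simp [field 3 h, Node.enc]) ?_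
      refine .jump rfl le_rfl (.done ?_)
      constructor <;> simp [h1, h2, hx0, hx1, hx2, hlt]
  | @rankYes x B base y no pre bits v _ h hb hp hle hx =>
    have hi := lt_len h
    refine rank h hb hp hle fun r h0 h1 h2 h4 h7 => ?_
    refine .leCoord rfl (v := 1) ?_ ?_
    · rw [if_pos (by simpa [hx0, hx1, hx2] using hx), hmod 1 (by omega) hi]
    refine .jump rfl (by simp [h4]) ?_
    refine .op rfl (v := (s.acc + (pre + v)) % 2 ^ w) (by simp [BinOp.eval, h2, h7]) ?_
    refine .op rfl (v := s.p - (pre + v)) ?_ ?_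
    · have : (s.p + (2 ^ w - (pre + v))) % 2 ^ w = s.p - (pre + v) := by
        rw [show s.p + (2 ^ w - (pre + v)) = s.p - (pre + v) + 2 ^ w by omega,
          Nat.add_mod_right, Nat.mod_eq_of_lt (by omega)]
      simpa [BinOp.eval, h1, h7] using this
    refine .load rfl (v := addr j) (by simp [h0, field 4 h, Node.enc]) ?_
    refine .jump rfl le_rfl (.done ?_)
    constructor <;> simp [hx0, hx1, hx2]
    omega
  | @rankNo x B base y no pre bits v _ h hb hp hle hx =>
    have hi := lt_len h
    refine rank h hb hp hle fun r h0 h1 h2 h4 h7 => ?_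
    refine .leCoord rfl (v := 0) (if_neg (by simpa [hx0, hx1, hx2] using hx)) ?_
    refine .skip rfl (by simp [h4]) ?_
    refine .op rfl (v := addr i + 5) (by simp [BinOp.eval, h0, h4, hmod, hi]) ?_
    refine .op rfl (v := pre + v) ?_ ?_
    · simpa [BinOp.eval, h7] using Nat.mod_eq_of_lt (by omega)
    refine .load rfl (v := addr j) (by simp [field 5 h, Node.enc]) ?_
    refine .jump rfl le_rfl (.done ?_)
    constructor <;> simp [h2, hx0, hx1, hx2]
    omega

theorem Reach.sim {w n e i j a b t : ℕ} {P : Finset Point3} {code : List Node} {q : Point3}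
    {s s' : St} {c : Config} (hw : 6 * code.length + n + 16 ≤ 2 ^ w) (hv : Valid P n code)
    (h : Reach code q t i s j s') (hc : Sim w (memOf code a b) q i s c) :
    Runs w (interp e) (60 * t) c (Sim w (memOf code a b) q j s') := by
  induction h generalizing c with
  | refl => exact .done hc
  | head h1 _ ih =>
    rw [Nat.mul_succ, Nat.add_comm]
    exact (h1.sim hw hv hc).trans fun c' hc' => ih hc'

/-- A run of the abstract machine from an entry point to `halt` yields a query of the RAM. -/
theorem interp_haltsWithin {w n a b e i j t : ℕ} {P : Finset Point3} {code : List Node}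
    {q : Point3} {s' : St} {T : ℝ} {post : ℕ → List Point3 → Prop}
    (hw : 6 * code.length + n + 16 ≤ 2 ^ w) (hv : Valid P n code)
    (hi : (memOf code a b)[e]? = some (.word (addr i))) (he : e < 2)
    (h : Reach code q t i ⟨0, 0, []⟩ j s') (hj : code[j]? = some .halt)
    (hT : (60 * t + 21 : ℕ) ≤ T) (hpost : post (s'.acc % 2 ^ w) s'.out) :
    HaltsWithin w (interp e) (memOf code a b) q T post := by
  have hjl : j < code.length := (List.getElem?_eq_some_iff.1 hj).1
  -- Two instructions load the entry point and 18 dispatch the final record; with the closing `halt`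
  -- this makes `60 * t + 21`.
  have key : Runs w (interp e) (2 + (60 * t + 18)) (Config.start (memOf code a b) q) fun c =>
      c.pc = 21 ∧ c.mem = memOf code a b ∧ c.reg 2 = s'.acc % 2 ^ w ∧ c.out = s'.out := by
    refine Runs.trans (Q' := Sim w (memOf code a b) q i ⟨0, 0, []⟩) ?_ fun c hc =>
      (h.sim hw hv hc).trans fun c' hc' => ?_
    · refine .const rfl (v := e) (Nat.mod_eq_of_lt (by omega)) ?_
      refine .load rfl (v := addr i) (by simpa using hi) (.done ?_)
      constructor <;> simp
    · obtain ⟨pc, reg, xreg, mem, out⟩ := c'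
      obtain ⟨rfl, hr0, hr1, hlt, hr2, hx0, hx1, hx2, rfl, rfl⟩ := hc'
      have hm := memOf_getElem? a b 0 hj (by omega)
      obtain ⟨t', ht', c'', hr, reg', rfl, h0, h1, h2, h4⟩ := runs_dispatch (w := w) (e := e) (o := 0)
        (a := addr j) (xreg := xreg) (out := s'.out) hr0 hm (by omega) (by simp only [addr]; omega)
      refine ⟨t', ht', _, hr, ?_⟩
      exact ⟨rfl, rfl, h2.trans hr2, rfl⟩
  obtain ⟨t', ht', c, hr, hpc, hmem, hacc, hout⟩ := key
  refine ⟨t', 2, c, le_trans ?_ hT, hr, by rw [hpc]; rfl, hmem, by rwa [hacc, hout]⟩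
  exact_mod_cast (by omega : t' + 1 ≤ 60 * t + 21)

/-! ### Building code -/

/-- The code `c₀` can be extended by at most `S` records such that some address `a` satisfies `R`
in all further extensions. -/
def Built (P : Finset Point3) (n S : ℕ) (R : List Node → ℕ → Prop) (c₀ : List Node) : Prop :=
  ∃ c₁ a, c₀ <+: c₁ ∧ c₁.length ≤ c₀.length + S ∧ Valid P n c₁ ∧ a < c₁.length ∧
    ∀ code, c₁ <+: code → R code a

section Built

variable {P : Finset Point3} {n S S' : ℕ} {R R' : List Node → ℕ → Prop} {c₀ : List Node}

/-- Records are only ever appended and `R` is required in all extensions, so finished code stays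
correct. Code is built back to front: the address at which a fragment continues must exist before
the fragment does. -/
theorem Built.bind (h : Built P n S R c₀)
    (h' : ∀ c₁ a, c₀ <+: c₁ → Valid P n c₁ → a < c₁.length → (∀ code, c₁ <+: code → R code a) →
      Built P n S' R' c₁) : Built P n (S + S') R' c₀ := by
  obtain ⟨c₁, a, h1, h2, h3, h4, h5⟩ := h
  obtain ⟨c₂, b, g1, g2, g3, g4, g5⟩ := h' c₁ a h1 h3 h4 h5
  exact ⟨c₂, b, h1.trans g1, by omega, g3, g4, g5⟩

theorem Built.mono (h : Built P n S R c₀) (hS : S ≤ S') : Built P n S' R c₀ := by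
  obtain ⟨c₁, a, h1, h2, h3⟩ := h
  exact ⟨c₁, a, h1, by omega, h3⟩

theorem Built.imp (h : Built P n S R c₀) (hR : ∀ code a, c₀ <+: code → R code a → R' code a) :
    Built P n S R' c₀ := by
  obtain ⟨c₁, a, h1, h2, h3, h4, h5⟩ := h
  exact ⟨c₁, a, h1, h2, h3, h4, fun code hc => hR code a (h1.trans hc) (h5 code hc)⟩

theorem Built.pure {a : ℕ} (hv : Valid P n c₀) (ha : a < c₀.length)
    (hR : ∀ code, c₀ <+: code → R code a) : Built P n S R c₀ :=
  ⟨c₀, a, List.prefix_rfl, by omega, hv, ha, hR⟩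

theorem Valid.append {l : List Node} (hv : Valid P n c₀)
    (hl : ∀ nd ∈ l, nd.Ok P n (c₀.length + l.length)) : Valid P n (c₀ ++ l) := by
  intro nd hnd
  rw [List.length_append]
  rcases List.mem_append.1 hnd with h | h
  · exact (hv nd h).mono (by omega)
  · exact hl nd h

theorem Built.emit {nd : Node} (hv : Valid P n c₀) (hok : nd.Ok P n (c₀.length + 1))
    (hR : ∀ code a, c₀ <+: code → code[a]? = some nd → R code a) : Built P n 1 R c₀ := by
  refine ⟨c₀ ++ [nd], c₀.length, List.prefix_append _ _, by simp, hv.append (by simpa using hok),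
    by simp, fun code hc => hR code _ ((List.prefix_append _ _).trans hc) ?_⟩
  obtain ⟨t, rfl⟩ := hc
  simp

end Built

open Classical in
/-- The number of points of a list with a first coordinate at most that of `q`. -/
noncomputable def cntX (q : Point3) (l : List Point3) : ℕ := l.countP fun p => p 0 ≤ q 0

open Classical in
/-- The points of a list that `q` dominates. -/
noncomputable def domList (q : Point3) (l : List Point3) : List Point3 :=
  l.filter fun p => Dominates q p

open Classical in
/-- The points of a list that `q` dominates in the first two coordinates. -/
noncomputable def domXY (q : Point3) (l : List Point3) : List Point3 :=
  l.filter fun p => p 0 ≤ q 0 ∧ p 1 ≤ q 1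

theorem isCoordOf {P : Finset Point3} {p : Point3} (h : p ∈ P) (i : Fin 3) : IsCoordOf P (p i) :=
  ⟨p, h, i, rfl⟩

/-! ### Reporting: priority search trees -/

theorem exists_minOn (l : List Point3) (h : l ≠ []) : ∃ r ∈ l, ∀ p ∈ l, r 1 ≤ p 1 := by
  obtain ⟨r, hr, hm⟩ := l.toFinset.exists_min_image (fun p => p 1)
    (by simpa [List.toFinset_nonempty_iff] using h)
  exact ⟨r, by simpa using hr, fun p hp => hm p (by simpa using hp)⟩

/-- A priority search tree reports the points dominated in the first two coordinates. -/
theorem built_reportXY {P : Finset Point3} {n : ℕ} (d : ℕ) (l : List Point3) (c₀ : List Node)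
    (k : ℕ) (hv : Valid P n c₀) (hk : k < c₀.length) (hs : l.Pairwise fun a b => a 0 ≤ b 0)
    (hP : ∀ p ∈ l, p ∈ P) (hl : l.length < 2 ^ d) :
    Built P n (4 * l.length) (fun code a => ∀ q s, ∃ t o,
      Reach code q t a s k { s with out := s.out ++ o } ∧ o.Perm (domXY q l) ∧
      t ≤ 6 * o.length + 6 * d + 2 ∧ ((∀ p ∈ l, p 0 ≤ q 0) → t ≤ 6 * o.length + 2) ∧
      ((∀ p ∈ l, ¬ p 0 ≤ q 0) → t ≤ 2)) c₀ := by
  -- Three time bounds are carried along because only one child of a node can be cut by `q 0`. A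
  -- child entirely inside the range costs no term in `d`, and one entirely outside costs at most 2.
  induction d generalizing l c₀ k with
  | zero =>
    obtain rfl : l = [] := by simpa using hl
    refine .pure hv hk fun code _ q s => ⟨0, [], ?_, by simp [domXY], by simp, by simp, by simp⟩
    simpa using Reach.refl
  | succ d ih =>
    rcases l.eq_nil_or_concat' with rfl | hne
    · refine .pure hv hk fun code _ q s => ⟨0, [], ?_, by simp [domXY], by simp, by simp, by simp⟩
      simpa using Reach.refl
    replace hne : l ≠ [] := by rintro rfl; simp at hne
    obtain ⟨r, hr, hmin⟩ := exists_minOn l hne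
    obtain ⟨x, hx, hxmin⟩ : ∃ x ∈ l, ∀ p ∈ l, x 0 ≤ p 0 := by
      cases l with
      | nil => simp at hne
      | cons x l => exact ⟨x, by simp, by simpa using (List.pairwise_cons.1 hs).1⟩
    set m := l.erase r with hm
    have hperm : l.Perm (r :: m) := List.perm_cons_erase hr
    have hlen : l.length = m.length + 1 := by simpa using hperm.length_eq
    have hms : m.Pairwise fun a b => a 0 ≤ b 0 := hs.sublist List.erase_sublist
    have hmP : ∀ p ∈ m, p ∈ P := fun p hp => hP p (List.mem_of_mem_erase hp)
    -- Without the root at most `2 ^ (d + 1) - 2` points are left, so both halves have fewer than `2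
    -- ^ d`.
    set h := 2 ^ d - 1 with hh
    have hpow : 2 ^ (d + 1) = 2 * 2 ^ d := by ring
    have hpos : 0 < 2 ^ d := by positivity
    set L := m.take h with hL
    set R := m.drop h with hR
    have hLR : L ++ R = m := List.take_append_drop h m
    have hLlen : L.length < 2 ^ d := by rw [hL, List.length_take]; omega
    have hRlen : R.length < 2 ^ d := by rw [hR, List.length_drop]; omega
    have hsum : L.length + R.length = m.length := by rw [← hLR, List.length_append]
    have hsplit := hms
    rw [← hLR, List.pairwise_append] at hsplit
    have hmem : ∀ p, p ∈ l ↔ p = r ∨ p ∈ L ∨ p ∈ R := by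
      intro p; rw [hperm.mem_iff, ← hLR]; simp
    refine Built.mono (S := R.length * 4 + (L.length * 4 + (1 + (1 + (1 + 1))))) ?_ (by omega)
    rw [Nat.mul_comm R.length, Nat.mul_comm L.length]
    refine (ih R c₀ k hv hk hsplit.2.1 (fun p hp => hmP p (List.mem_of_mem_drop hp)) hRlen).bind
      fun c₁ a₁ h01 hv1 ha1 hR1 => ?_
    refine (ih L c₁ a₁ hv1 ha1 hsplit.1 (fun p hp => hmP p (List.mem_of_mem_take hp)) hLlen).bind
      fun c₂ a₂ h12 hv2 ha2 hR2 => ?_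
    refine (Built.emit (nd := .report r a₂) hv2 ⟨hP r hr, by omega⟩ fun code a _ ha => ha).bind
      fun c₃ a₃ h23 hv3 ha3 hR3 => ?_
    have l12 := h12.length_le
    have l23 := h23.length_le
    have l01 := h01.length_le
    refine (Built.emit (nd := .cmp 0 (r 0) a₃ a₂) hv3
      ⟨isCoordOf (hP r hr) 0, by omega, by omega⟩ fun code a _ ha => ha).bind
      fun c₄ a₄ h34 hv4 ha4 hR4 => ?_
    have l34 := h34.length_le
    -- The test against the least first coordinate leaves a subtree outside the range at once, which
    -- gives the bound 2.
    refine (Built.emit (nd := .cmp 0 (x 0) a₄ k) hv4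
      ⟨isCoordOf (hP x hx) 0, by omega, by omega⟩ fun code a _ ha => ha).bind
      fun c₅ a₅ h45 hv5 ha5 hR5 => ?_
    have l45 := h45.length_le
    refine Built.emit (nd := .cmp 1 (r 1) a₅ k) hv5
      ⟨isCoordOf (hP r hr) 1, by omega, by omega⟩ fun code a hc ha q s => ?_
    replace hR5 := hR5 code hc
    replace hR4 := hR4 code (h45.trans hc)
    replace hR3 := hR3 code (h34.trans (h45.trans hc))
    replace hR2 := hR2 code (h23.trans (h34.trans (h45.trans hc))) q
    replace hR1 := hR1 code (h12.trans (h23.trans (h34.trans (h45.trans hc)))) q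
    by_cases hy : r 1 ≤ q 1
    swap
    · refine ⟨1, [], by simpa using Reach.head (.cmpNo ha hy) .refl, ?_, by simp, by simp,
        by simp⟩
      have : domXY q l = [] := by
        simp only [domXY, List.filter_eq_nil_iff, decide_eq_true_eq, not_and]
        exact fun p hp _ h' => hy ((hmin p hp).trans h')
      rw [this]
    by_cases hxq : x 0 ≤ q 0
    swap
    · refine ⟨2, [], by simpa using Reach.head (.cmpYes ha hy) (.head (.cmpNo hR5 hxq) .refl), ?_,
        by simp, by simp, by simp⟩
      have : domXY q l = [] := by
        simp only [domXY, List.filter_eq_nil_iff, decide_eq_true_eq, not_and]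
        exact fun p hp h' => absurd ((hxmin p hp).trans h') hxq
      rw [this]
    have hnone : ¬ ∀ p ∈ l, ¬ p 0 ≤ q 0 := fun h => h x hx hxq
    have hroot : ∃ t₀ ≤ 4, ∃ o₀, Reach code q t₀ a s a₂ { s with out := s.out ++ o₀ } ∧
        o₀.Perm (domXY q [r]) ∧ (r 0 ≤ q 0 → o₀.length = 1) := by
      by_cases hxr : r 0 ≤ q 0
      · exact ⟨4, le_rfl, [r], .head (.cmpYes ha hy) (.head (.cmpYes hR5 hxq)
          (.head (.cmpYes hR4 hxr) (.head (.report hR3) .refl))), by simp [domXY, hxr, hy], by simp⟩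
      · refine ⟨3, by omega, [], ?_, by simp [domXY, hxr], fun h' => absurd h' hxr⟩
        simpa using Reach.head (.cmpYes ha hy) (.head (.cmpYes hR5 hxq)
          (.head (.cmpNo hR4 hxr) .refl))
    obtain ⟨t₀, ht₀, o₀, hreach₀, hperm₀, hone⟩ := hroot
    obtain ⟨t₂, o₂, hreach₂, hperm₂, hgen₂, hall₂, -⟩ := hR2 { s with out := s.out ++ o₀ }
    obtain ⟨t₁, o₁, hreach₁, hperm₁, hgen₁, hall₁, hnone₁⟩ :=
      hR1 { s with out := s.out ++ o₀ ++ o₂ }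
    refine ⟨t₀ + (t₂ + t₁), o₀ ++ (o₂ ++ o₁), ?_, ?_, ?_, fun h' => ?_, fun h' => absurd h' hnone⟩
    · rw [← List.append_assoc, ← List.append_assoc]
      exact hreach₀.trans (hreach₂.trans hreach₁)
    · refine (hperm₀.append (hperm₂.append hperm₁)).trans ?_
      rw [domXY, domXY, domXY, ← List.filter_append, ← List.filter_append, hLR,
        List.singleton_append]
      exact (hperm.filter _).symm
    · simp only [List.length_append]
      -- If `R` meets the range, then all of `L` lies within it; otherwise `R` costs at most 2.
      -- Either way only one child contributes a term `6 * d`.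
      by_cases hR' : ∀ p ∈ R, ¬ p 0 ≤ q 0
      · have := hnone₁ hR'
        omega
      · push Not at hR'
        obtain ⟨p, hp, hpq⟩ := hR'
        have := hall₂ fun p' hp' => (hsplit.2.2 p' hp' p hp).trans hpq
        omega
    · simp only [List.length_append]
      -- The root is reported, and its 6 units pay for its own 4 steps and for the constant 2 of one
      -- child.
      have h0 := hone (h' r hr)
      have h1 := hall₁ fun p hp => h' p ((hmem p).2 (.inr (.inr hp)))
      have h2 := hall₂ fun p hp => h' p ((hmem p).2 (.inr (.inl hp)))
      omega

/-! ### Rank structures -/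

/-- The number of ones in the binary representation. -/
def bitCount (v : ℕ) : ℕ := (Nat.digits 2 v).sum

/-- The number with given binary digits, the lowest one first. -/
def bitVal : List Bool → ℕ
  | [] => 0
  | b :: l => b.toNat + 2 * bitVal l

theorem bitVal_lt (l : List Bool) : bitVal l < 2 ^ l.length := by
  induction l with
  | nil => simp [bitVal]
  | cons b l ih =>
    have := b.toNat_lt
    simp only [bitVal, List.length_cons, pow_succ]
    omega

/-- With the lowest digit first, masking a block cuts it down to a prefix; this reduces a rank
inside a block to a table lookup. -/
theorem bitVal_mod (l : List Bool) (r : ℕ) : bitVal l % 2 ^ r = bitVal (l.take r) := by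
  induction l generalizing r with
  | nil => simp [bitVal]
  | cons b l ih =>
    cases r with
    | zero => simp [bitVal, Nat.mod_one]
    | succ r =>
      have := b.toNat_lt
      simp only [bitVal, List.take_succ_cons, ← ih, pow_succ']
      rw [Nat.mod_mul, Nat.add_mul_mod_self_left, Nat.mod_eq_of_lt this,
        Nat.add_mul_div_left _ _ (by omega), Nat.div_eq_of_lt this, Nat.zero_add]

theorem bitCount_bitVal (l : List Bool) : bitCount (bitVal l) = l.countP id := by
  induction l with
  | nil => simp [bitCount, bitVal]
  | cons b l ih =>
    have : bitCount (b.toNat + 2 * bitVal l) = b.toNat + bitCount (bitVal l) := by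
      rcases Nat.eq_zero_or_pos (b.toNat + 2 * bitVal l) with h | h
      · obtain ⟨h1, h2⟩ : b.toNat = 0 ∧ bitVal l = 0 := by omega
        simp [h1, h2, bitCount]
      · have hb := b.toNat_lt
        rw [bitCount, Nat.digits_def' (by omega) h, Nat.add_mul_mod_self_left, Nat.mod_eq_of_lt hb,
          Nat.add_mul_div_left _ _ (by omega), Nat.div_eq_of_lt hb, Nat.zero_add, List.sum_cons,
          bitCount]
    rw [bitVal, this, ih, List.countP_cons]
    cases b <;> simp [Nat.add_comm]

/-- The table of bit counts of numbers with `B` bits. -/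
def popTable (B : ℕ) : List Node := (List.range (2 ^ B)).map fun v => .pop (bitCount v)

theorem popTable_getElem? {B v : ℕ} {code : List Node} (h : popTable B <+: code)
    (hv : v < 2 ^ B) : code[v]? = some (.pop (bitCount v)) := by
  obtain ⟨t, rfl⟩ := h
  rw [List.getElem?_append_left (by simpa [popTable] using hv)]
  simp [popTable, hv]

theorem valid_popTable {P : Finset Point3} {n B : ℕ} (hB : 2 ^ B ≤ n) : Valid P n (popTable B) := by
  intro nd hnd
  simp only [popTable, List.mem_map, List.mem_range] at hnd
  obtain ⟨v, hv, rfl⟩ := hnd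
  exact (Nat.digit_sum_le 2 v).trans (by omega)

/-- The rank structure of the bit vector `l.map f`, with `B` bits per block. -/
def blocks (B : ℕ) (f : Point3 → Bool) (l : List Point3) : List Node :=
  -- The additional block, possibly empty, keeps the lookup at position `l.length` inside the
  -- structure.
  (List.range (l.length / B + 1)).map fun j =>
    .block ((l.take (j * B)).countP f) (bitVal (((l.drop (j * B)).take B).map f))

theorem length_blocks (B : ℕ) (f : Point3 → Bool) (l : List Point3) :
    (blocks B f l).length = l.length / B + 1 := by simp [blocks]

theorem blocks_ok {P : Finset Point3} {n B L : ℕ} (f : Point3 → Bool) (l : List Point3)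
    (hB : 2 ^ B ≤ n) (hl : l.length ≤ n) : ∀ nd ∈ blocks B f l, nd.Ok P n L := by
  intro nd hnd
  simp only [blocks, List.mem_map] at hnd
  obtain ⟨j, -, rfl⟩ := hnd
  refine ⟨List.countP_le_length.trans ((List.length_take_le' _ _).trans hl), ?_⟩
  refine (bitVal_lt _).le.trans ((Nat.pow_le_pow_right (by omega) ?_).trans hB)
  simp

/-- Reading off a rank. -/
theorem rank_blocks {B base p : ℕ} {f : Point3 → Bool} {l : List Point3} {code : List Node}
    (hB : 0 < B) (htbl : popTable B <+: code) (hp : p ≤ l.length)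
    (hbl : ∀ j, j < l.length / B + 1 → code[base + j]? = (blocks B f l)[j]?) :
    ∃ pre bits v, code[base + p / B]? = some (.block pre bits) ∧
      code[bits % 2 ^ (p % B)]? = some (.pop v) ∧ pre + v = (l.take p).countP f := by
  have hj : p / B < l.length / B + 1 := Nat.lt_succ_of_le (Nat.div_le_div_right hp)
  have hlt := Nat.mod_lt p hB
  refine ⟨(l.take (p / B * B)).countP f, bitVal (((l.drop (p / B * B)).take B).map f),
    bitCount (bitVal (((l.drop (p / B * B)).take (p % B)).map f)), ?_, ?_, ?_⟩
  · rw [hbl _ hj]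
    simp [blocks, hj]
  · rw [bitVal_mod, ← List.map_take, List.take_take, min_eq_left hlt.le]
    refine popTable_getElem? htbl ((bitVal_lt _).trans_le (Nat.pow_le_pow_right (by omega) ?_))
    simp; omega
  · rw [bitCount_bitVal, List.countP_map, Function.id_comp, ← List.countP_append, ← List.take_add,
      Nat.div_add_mod']

/-! ### Counting: wavelet trees -/

theorem exists_sorted (i : Fin 3) (l : List Point3) :
    ∃ s : List Point3, s.Perm l ∧ s.Pairwise fun a b => a i ≤ b i := by
  classical
  let r : Point3 → Point3 → Prop := fun a b => a i ≤ b i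
  have : Std.Total r := ⟨fun a b => le_total (a i) (b i)⟩
  have : IsTrans Point3 r := ⟨fun a b c h h' => le_trans h h'⟩
  exact ⟨l.insertionSort r, l.perm_insertionSort r, l.pairwise_insertionSort r⟩

/-- A list can be split in halves by the first coordinate. -/
theorem exists_halving {P : Finset Point3} (l : List Point3) (hnd : l.Nodup)
    (hP : ∀ p ∈ l, p ∈ P) (hl : 2 ≤ l.length) :
    ∃ (f : Point3 → Bool) (c : ℝ), IsCoordOf P c ∧ (l.filter f).length = l.length / 2 ∧
      (∀ p ∈ l, f p → p 0 ≤ c) ∧ ∀ p ∈ l, ¬ f p → c ≤ p 0 := by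
  classical
  obtain ⟨s, hs, hsort⟩ := exists_sorted 0 l
  have hlen := hs.length_eq
  obtain ⟨y, hy⟩ : ∃ y, s.drop (l.length / 2) = y :: (s.drop (l.length / 2)).tail := by
    cases h : s.drop (l.length / 2) with
    | nil => rw [List.drop_eq_nil_iff] at h; omega
    | cons y t => exact ⟨y, rfl⟩
  have hts := List.take_append_drop (l.length / 2) s
  have hsort' := hsort
  rw [← hts, List.pairwise_append] at hsort'
  have hnd' := hs.nodup_iff.2 hnd
  rw [← hts, List.nodup_append] at hnd'
  have hyl : y ∈ l := hs.subset (List.mem_of_mem_drop (hy ▸ List.mem_cons_self))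
  -- The halves are defined by membership in a prefix and not by a comparison with `y 0`, so equal
  -- coordinates do not spoil the balance.
  refine ⟨fun p => decide (p ∈ s.take (l.length / 2)), y 0, isCoordOf (hP y hyl) 0, ?_, ?_, ?_⟩
  · rw [← (hs.filter _).length_eq]
    conv_lhs => rw [← hts]
    rw [List.filter_append, List.filter_eq_self.2 (by simp), List.filter_eq_nil_iff.2]
    · simp; omega
    · intro p hp hp'
      exact hnd'.2.2 p (by simpa using hp') p hp rfl
  · intro p _ hfp
    exact hsort'.2.2 p (by simpa using hfp) y (by rw [hy]; exact List.mem_cons_self)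
  · intro p hp hfp
    have : p ∈ s.drop (l.length / 2) := by
      have := hs.symm.subset hp
      rw [← hts, List.mem_append] at this
      exact this.resolve_left (by simpa using hfp)
    rw [hy, List.mem_cons] at this
    rcases this with rfl | h
    · exact le_rfl
    · have h3 := hsort'.2.1
      rw [hy, List.pairwise_cons] at h3
      exact h3.1 p h

/-- This is why a wavelet tree needs only a position: a prefix of the list induces prefixes of both
children, whose lengths are given by a rank. -/
theorem filter_take {α : Type*} (f : α → Bool) (l : List α) (p : ℕ) :
    (l.take p).filter f = (l.filter f).take ((l.take p).countP f) := by
  conv_rhs => rw [← List.take_append_drop p l, List.filter_append]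
  rw [List.take_append_drop, List.take_left']
  exact (List.countP_eq_length_filter ..).symm

theorem cntX_eq_add (q : Point3) (f : Point3 → Bool) (l : List Point3) :
    cntX q l = cntX q (l.filter f) + cntX q (l.filter fun p => !f p) := by
  classical
  induction l with
  | nil => rfl
  | cons a l ih =>
    simp only [cntX] at ih ⊢
    rw [List.countP_cons, ih]
    cases h : f a <;> simp [h, List.countP_cons] <;> omega

/-- The leaves of the wavelet tree. With a single point the position is 0 or 1, so adding the
position counts the point exactly if it is in the prefix. -/
theorem built_wavelet_small {P : Finset Point3} {n B : ℕ} (d : ℕ)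
    (l : List Point3) (c₀ : List Node) (k : ℕ) (hv : Valid P n c₀)
    (hk : k < c₀.length) (hP : ∀ p ∈ l, p ∈ P) (hl : l.length ≤ 1) :
    Built P n (4 * l.length - 2 + l.length * d / B) (fun code a => ∀ q s, s.p ≤ l.length →
      ∃ t p', t ≤ d + 2 ∧
        Reach code q t a s k ⟨p', s.acc + cntX q (l.take s.p), s.out⟩) c₀ := by
  match l, hl with
  | [], _ =>
    refine .pure hv hk fun code _ q s hs => ⟨0, s.p, by omega, ?_⟩
    simpa [cntX] using Reach.refl
  | [x], _ =>
    refine Built.mono (S := 1 + 1) ?_ (by simp)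
    refine (Built.emit (nd := .addPos k) hv (show k < _ by omega) fun code a _ ha => ha).bind
      fun c₁ a₁ h01 hv1 ha1 hR1 => ?_
    have l01 := h01.length_le
    refine .emit (nd := .cmp 0 (x 0) a₁ k) hv1
      ⟨isCoordOf (hP x (by simp)) 0, by omega, by omega⟩ fun code a hc ha q s hs => ?_
    by_cases hx : x 0 ≤ q 0
    · refine ⟨2, s.p, by omega, ?_⟩
      have : cntX q ([x].take s.p) = s.p := by
        have : s.p = 0 ∨ s.p = 1 := by simp at hs; omega
        rcases this with h | h <;> simp [h, cntX, hx]
      rw [this]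
      exact .head (.cmpYes ha hx) (.head (.addPos (hR1 code hc)) .refl)
    · refine ⟨1, s.p, by omega, ?_⟩
      have : cntX q ([x].take s.p) = 0 := by
        have : s.p = 0 ∨ s.p = 1 := by simp at hs; omega
        rcases this with h | h <;> simp [h, cntX, hx]
      rw [this]
      exact .head (.cmpNo ha hx) .refl

/-- A wavelet tree counts, in a prefix of a list, the points with a bounded first coordinate. -/
theorem built_wavelet {P : Finset Point3} {n B : ℕ} (hB : 0 < B) (hBn : 2 ^ B ≤ n) (d : ℕ)
    (l : List Point3) (c₀ : List Node) (k : ℕ) (htbl : popTable B <+: c₀) (hv : Valid P n c₀)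
    (hk : k < c₀.length) (hnd : l.Nodup) (hP : ∀ p ∈ l, p ∈ P) (hl : l.length ≤ 2 ^ d)
    (hn : l.length ≤ n) :
    Built P n (4 * l.length - 2 + l.length * d / B) (fun code a => ∀ q s, s.p ≤ l.length →
      ∃ t p', t ≤ d + 2 ∧
        Reach code q t a s k ⟨p', s.acc + cntX q (l.take s.p), s.out⟩) c₀ := by
  induction d generalizing l c₀ k with
  | zero => exact built_wavelet_small 0 l c₀ k hv hk hP (by simpa using hl)
  | succ d ih =>
    rcases Nat.lt_or_ge l.length 2 with h2 | h2
    · exact built_wavelet_small (d + 1) l c₀ k hv hk hP (by omega)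
    obtain ⟨f, c, hc, hlen, hle, hge⟩ := exists_halving l hnd hP h2
    set L := l.filter f with hL
    set R := l.filter fun p => !f p with hR
    have hsum : L.length + R.length = l.length := by
      exact (List.length_eq_length_filter_add f).symm
    rw [pow_succ] at hl
    have htbl' : ∀ {c}, c₀ <+: c → popTable B <+: c := fun h => htbl.trans h
    -- Apart from `l.length / B` blocks, an inner node needs 2 records. Both halves are nonempty, so
    -- the two terms `-2` of the children pay for these and leave one `-2`.
    refine Built.mono (S := (4 * R.length - 2 + R.length * d / B) +
      ((4 * L.length - 2 + L.length * d / B) + (l.length / B + 1 + 1))) ?_ ?_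
    · refine (ih R c₀ k htbl hv hk (hnd.filter _) (fun p hp => hP p (List.mem_of_mem_filter hp))
        (by omega) (by omega)).bind fun c₁ a₁ h01 hv1 ha1 hR1 => ?_
      have l01 := h01.length_le
      refine (ih L c₁ k (htbl' h01) hv1 (by omega) (hnd.filter _)
        (fun p hp => hP p (List.mem_of_mem_filter hp)) (by omega) (by omega)).bind
        fun c₂ a₂ h12 hv2 ha2 hR2 => ?_
      have l12 := h12.length_le
      have hv3 : Valid P n (c₂ ++ blocks B f l) := hv2.append (blocks_ok f l hBn hn)
      have hlen3 : (c₂ ++ blocks B f l).length = c₂.length + (l.length / B + 1) := by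
        rw [List.length_append, length_blocks]
      refine Built.bind (S := l.length / B + 1) (R := fun code base =>
        ∀ j, j < l.length / B + 1 → code[base + j]? = (blocks B f l)[j]?)
        ⟨c₂ ++ blocks B f l, c₂.length, List.prefix_append _ _, hlen3.le, hv3,
          by rw [hlen3]; exact Nat.lt_add_of_pos_right (Nat.succ_pos _), ?_⟩
        fun c₃ base h23 hv3 hbase hbl => ?_
      · rintro _ ⟨t, rfl⟩ j hj
        rw [List.append_assoc, List.getElem?_append_right (by omega), Nat.add_sub_cancel_left,
          List.getElem?_append_left (by rwa [length_blocks])]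
      have l23 := h23.length_le
      refine .emit (nd := .rank c B base a₁ a₂) hv3
        ⟨hc, hB, hBn, by omega, by omega, by omega⟩ fun code a hc3 ha q s hs => ?_
      obtain ⟨pre, bits, v, hb, hpop, hr⟩ := rank_blocks (f := f) hB
        ((htbl' h01).trans (h12.trans (h23.trans hc3))) hs (hbl code hc3)
      have hcomp : (l.take s.p).countP f + (l.take s.p).countP (fun p => !f p) = s.p := by
        rw [List.countP_eq_length_filter, List.countP_eq_length_filter,
          ← List.length_eq_length_filter_add f, List.length_take, min_eq_left hs]
      have hpre : pre + v ≤ s.p := by omega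
      have htake := filter_take f l s.p
      have htake' := filter_take (fun p => !f p) l s.p
      rw [← hL, ← hr] at htake
      rw [← hR, show (l.take s.p).countP (fun p => !f p) = s.p - (pre + v) by omega] at htake'
      have hsplit := cntX_eq_add q f (l.take s.p)
      rw [htake, htake'] at hsplit
      have hle1 : pre + v ≤ L.length := by
        rw [hr, List.countP_eq_length_filter]
        exact ((List.take_sublist _ _).filter f).length_le
      have hle2 : s.p - (pre + v) ≤ R.length := by
        rw [show s.p - (pre + v) = (l.take s.p).countP (fun p => !f p) by omega,
          List.countP_eq_length_filter]
        exact ((List.take_sublist _ _).filter _).length_le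
      -- If `c ≤ q 0`, the prefix of `L` counts completely and the search goes on in `R`; otherwise
      -- nothing in `R` counts and it goes on in `L`.
      by_cases hcq : c ≤ q 0
      · obtain ⟨t, p', ht, h⟩ := hR1 code (h12.trans (h23.trans hc3)) q
          ⟨s.p - (pre + v), s.acc + (pre + v), s.out⟩ hle2
        refine ⟨t + 1, p', by omega, ?_⟩
        have : cntX q (L.take (pre + v)) = pre + v := by
          rw [cntX, List.countP_eq_length.2, List.length_take, min_eq_left hle1]
          intro p hp
          have := List.mem_filter.1 (List.mem_of_mem_take hp)
          simpa using (hle p this.1 this.2).trans hcq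
        rw [hsplit, this, ← Nat.add_assoc]
        exact .head (.rankYes ha hb hpop hpre hcq) h
      · obtain ⟨t, p', ht, h⟩ := hR2 code (h23.trans hc3) q ⟨pre + v, s.acc, s.out⟩ hle1
        refine ⟨t + 1, p', by omega, ?_⟩
        have : cntX q (R.take (s.p - (pre + v))) = 0 := by
          rw [cntX, List.countP_eq_zero]
          intro p hp
          have := List.mem_filter.1 (List.mem_of_mem_take hp)
          simpa using (lt_of_not_ge hcq).trans_le (hge p this.1 (by simpa using this.2))
        rw [hsplit, this, Nat.add_zero]
        exact .head (.rankNo ha hb hpop hpre hcq) h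
    · have h1 : R.length * d / B + L.length * d / B ≤ (R.length * d + L.length * d) / B :=
        Nat.div_add_div_le_add_div
      have h3 : (R.length * d + L.length * d) / B + l.length / B ≤
          (R.length * d + L.length * d + l.length) / B := Nat.div_add_div_le_add_div
      have h4 : R.length * d + L.length * d + l.length = l.length * (d + 1) := by
        rw [← hsum]; ring
      rw [h4] at h3
      omega

/-! ### Counting: ranks -/

open Classical in
/-- The number of points of a list with a second coordinate at most that of `q`. -/
noncomputable def cntY (q : Point3) (l : List Point3) : ℕ := l.countP fun p => p 1 ≤ q 1

/-- A search tree computes ranks with respect to the second coordinate. -/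
theorem built_search {P : Finset Point3} {n : ℕ} (d : ℕ) (l : List Point3) (off : ℕ)
    (c₀ : List Node) (k : ℕ) (hv : Valid P n c₀) (hk : k < c₀.length)
    (hs : l.Pairwise fun a b => a 1 ≤ b 1) (hP : ∀ p ∈ l, p ∈ P) (hl : l.length < 2 ^ d)
    (hn : off + l.length ≤ n) :
    Built P n (2 * l.length + 1) (fun code a => ∀ q s, ∃ t ≤ d + 1,
      Reach code q t a s k { s with p := off + cntY q l }) c₀ := by
  -- A leaf stores the answer: `off` is the number of points that precede the current sublist in the
  -- whole list.
  have empty : ∀ d off c₀ k, Valid P n c₀ → k < c₀.length → off ≤ n →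
      Built P n 1 (fun code a => ∀ q s, ∃ t ≤ d + 1,
        Reach code q t a s k { s with p := off }) c₀ := fun d off c₀ k hv hk hn =>
    .emit (nd := .setPos off k) hv ⟨hn, by omega⟩
      fun code a hc ha q s => ⟨1, by omega, .head (.setPos ha) .refl⟩
  induction d generalizing l off c₀ k with
  | zero =>
    obtain rfl : l = [] := by simpa using hl
    exact empty 0 off c₀ k hv hk hn
  | succ d ih =>
    by_cases hne : l = []
    · subst hne; exact empty _ off c₀ k hv hk hn
    have hpos := List.length_pos_iff.2 hne
    obtain ⟨L, m, R, rfl, hL, hR⟩ : ∃ L m R, l = L ++ m :: R ∧ L.length < 2 ^ d ∧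
        R.length < 2 ^ d := by
      have hi : l.length / 2 < l.length := by omega
      refine ⟨l.take (l.length / 2), l[l.length / 2], l.drop (l.length / 2 + 1), ?_, ?_, ?_⟩
      · simp
      · rw [List.length_take]; omega
      · rw [List.length_drop]; omega
    simp only [List.length_append, List.length_cons] at *
    have hs' := hs
    rw [List.pairwise_append, List.pairwise_cons] at hs'
    refine Built.mono (S := (2 * R.length + 1) + ((2 * L.length + 1) + 1)) ?_ (by omega)
    refine (ih R (off + L.length + 1) c₀ k hv hk hs'.2.1.2 (fun p hp => hP p (by simp [hp])) hR
      (by omega)).bind fun c₁ a₁ h01 hv1 ha1 hR1 => ?_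
    have l01 := h01.length_le
    refine (ih L off c₁ k hv1 (by omega) hs'.1 (fun p hp => hP p (by simp [hp])) hL
      (by omega)).bind fun c₂ a₂ h12 hv2 ha2 hR2 => ?_
    have l12 := h12.length_le
    refine .emit (nd := .cmp 1 (m 1) a₁ a₂) hv2
      ⟨isCoordOf (hP m (by simp)) 1, by omega, by omega⟩ fun code a hc ha q s => ?_
    by_cases hm : m 1 ≤ q 1
    · obtain ⟨t, ht, h⟩ := hR1 code (h12.trans hc) q s
      refine ⟨t + 1, by omega, ?_⟩
      have : cntY q (L ++ m :: R) = L.length + 1 + cntY q R := by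
        rw [cntY, List.countP_append, List.countP_cons_of_pos (by simpa using hm),
          List.countP_eq_length.2, ← cntY]
        · omega
        · exact fun p hp => by simpa using (hs'.2.2 p hp m (by simp)).trans hm
      rw [this, ← Nat.add_assoc, ← Nat.add_assoc]
      exact .head (.cmpYes ha hm) h
    · obtain ⟨t, ht, h⟩ := hR2 code hc q s
      refine ⟨t + 1, by omega, ?_⟩
      have : cntY q (L ++ m :: R) = cntY q L := by
        rw [cntY, List.countP_append, (List.countP_eq_zero (l := m :: R)).2, ← cntY, Nat.add_zero]
        intro p hp
        rcases List.mem_cons.1 hp with rfl | hp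
        · simpa using hm
        · simpa using (lt_of_not_ge hm).trans_le (hs'.2.1.1 p hp)
      rw [this]
      exact .head (.cmpNo ha hm) h

/-- In a list sorted by the second coordinate, the points that satisfy the second constraint form a
prefix. This joins the search tree to the wavelet tree. -/
theorem take_cntY {q : Point3} {l : List Point3} (hs : l.Pairwise fun a b => a 1 ≤ b 1) :
    cntX q (l.take (cntY q l)) = (domXY q l).length := by
  classical
  induction l with
  | nil => rfl
  | cons x l ih =>
    rw [List.pairwise_cons] at hs
    have ih := ih hs.2
    by_cases hx : x 1 ≤ q 1
    · have h1 : cntY q (x :: l) = cntY q l + 1 := List.countP_cons_of_pos (by simpa using hx)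
      rw [h1, List.take_succ_cons]
      simp only [cntX, domXY] at ih ⊢
      rw [List.countP_cons, List.filter_cons, ih]
      by_cases hx0 : x 0 ≤ q 0 <;> simp [hx, hx0]
    · have h1 : ∀ p ∈ x :: l, ¬ p 1 ≤ q 1 := by
        intro p hp
        rcases List.mem_cons.1 hp with rfl | hp
        · exact hx
        · exact fun h => hx ((hs.1 p hp).trans h)
      have h2 : cntY q (x :: l) = 0 := by
        rw [cntY, List.countP_eq_zero]
        simpa using h1
      have h3 : domXY q (x :: l) = [] := by
        rw [domXY, List.filter_eq_nil_iff]
        intro p hp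
        have := h1 p hp
        simp [this]
      rw [h2, h3]
      rfl

/-- Counting the points dominated in the first two coordinates. -/
theorem built_countXY {P : Finset Point3} {n B : ℕ} (hB : 0 < B) (hBn : 2 ^ B ≤ n)
    (hnB : n < 2 ^ (B + 1)) (l : List Point3) (c₀ : List Node) (k : ℕ)
    (htbl : popTable B <+: c₀) (hv : Valid P n c₀) (hk : k < c₀.length) (hne : l ≠ [])
    (hnd : l.Nodup) (hP : ∀ p ∈ l, p ∈ P) (hn : l.length ≤ n) :
    Built P n (9 * l.length) (fun code a => ∀ q s, ∃ t p', t ≤ 2 * B + 5 ∧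
      Reach code q t a s k ⟨p', s.acc + (domXY q l).length, s.out⟩) c₀ := by
  obtain ⟨s, hperm, hsort⟩ := exists_sorted 1 l
  have hlen := hperm.length_eq
  have hpos := List.length_pos_iff.2 hne
  have hnds := hperm.nodup_iff.2 hnd
  have hPs : ∀ p ∈ s, p ∈ P := fun p hp => hP p (hperm.subset hp)
  refine Built.mono (S := (4 * s.length - 2 + s.length * (B + 1) / B) + (2 * s.length + 1)) ?_ ?_
  · refine (built_wavelet hB hBn (B + 1) s c₀ k htbl hv hk hnds hPs (by omega)
      (by omega)).bind fun c₁ a₁ h01 hv1 ha1 hR1 => ?_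
    refine (built_search (B + 1) s 0 c₁ a₁ hv1 ha1 hsort hPs (by omega) (by omega)).imp
      fun code a hc hR q st => ?_
    obtain ⟨t, ht, h⟩ := hR q st
    obtain ⟨t', p', ht', h'⟩ := hR1 code hc q { st with p := 0 + cntY q s } (by
      simpa [cntY] using List.countP_le_length)
    refine ⟨t + t', p', by omega, ?_⟩
    have hcnt : (domXY q l).length = cntX q (s.take (cntY q s)) := by
      rw [take_cntY hsort]
      exact (hperm.filter _).length_eq.symm
    rw [hcnt]
    simpa using h.trans h'
  -- Here packing pays off: `B + 1` levels of bits, with `B` bits per word, cost at most two words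
  -- per point.
  · have : s.length * (B + 1) / B ≤ 2 * s.length := by
      refine Nat.div_le_of_le_mul ?_
      nlinarith
    omega

/-! ### Trees over the third coordinate -/

theorem exists_maxOn (l : List Point3) (h : l ≠ []) : ∃ r ∈ l, ∀ p ∈ l, p 2 ≤ r 2 := by
  obtain ⟨r, hr, hm⟩ := l.toFinset.exists_max_image (fun p => p 2)
    (by simpa [List.toFinset_nonempty_iff] using h)
  exact ⟨r, by simpa using hr, fun p hp => hm p (by simpa using hp)⟩

theorem domList_append (q : Point3) (l l' : List Point3) :
    domList q (l ++ l') = domList q l ++ domList q l' := List.filter_append ..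

theorem domList_eq_nil {q : Point3} {l : List Point3} (h : ∀ p ∈ l, ¬ Dominates q p) :
    domList q l = [] := by
  simpa [domList] using h

theorem domXY_eq_domList {q : Point3} {l : List Point3} (h : ∀ p ∈ l, p 2 ≤ q 2) :
    domXY q l = domList q l := by
  refine List.filter_congr fun p hp => ?_
  simp [Dominates, Fin.forall_fin_succ, h p hp]

/-- The third coordinate is handled by a tree of degree `lam`: a two-dimensional data structure,
built for every node, serves the query at the nodes entirely below the query point. The relation
`E q l` is the effect of a query `q` on a list `l`. -/
theorem built_tree {P : Finset Point3} {n K A D lam : ℕ} {tbl : List Node}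
    {E : Point3 → List Point3 → St → St → Prop} (hlam : 0 < lam)
    (hnone : ∀ q l s, (∀ p ∈ l, ¬ Dominates q p) → E q l s s)
    (happ : ∀ q l l' s s' s'', E q l s s' → E q l' s' s'' → E q (l ++ l') s s'')
    (hXY : ∀ l c₀ k, tbl <+: c₀ → Valid P n c₀ → k < c₀.length → l ≠ [] → l.Nodup →
      (∀ p ∈ l, p ∈ P) → l.length ≤ n →
      Built P n (K * l.length) (fun code a => ∀ q s, (∀ p ∈ l, p 2 ≤ q 2) → ∃ t s',
        Reach code q t a s k s' ∧ E q l s s' ∧ t ≤ A + D * (domList q l).length) c₀)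
    (d : ℕ) (l : List Point3) (c₀ : List Node) (k : ℕ) (htbl : tbl <+: c₀) (hv : Valid P n c₀)
    (hk : k < c₀.length) (hnd : l.Nodup) (hP : ∀ p ∈ l, p ∈ P) (hn : l.length ≤ n)
    (hs : l.Pairwise fun a b => a 2 ≤ b 2) (hl : l.length ≤ lam ^ d) :
    Built P n ((K + 1) * (d + 1) * l.length) (fun code a => ∀ q s, ∃ t s',
      Reach code q t a s k s' ∧ E q l s s' ∧
      t ≤ (A + 1) * (lam * d + 1) + D * (domList q l).length) c₀ := by
  induction d generalizing l c₀ k with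
  | zero =>
    by_cases hne : l = []
    · subst hne
      exact .pure hv hk fun code _ q s => ⟨0, s, .refl, hnone _ _ _ (by simp), by omega⟩
    have hpos := List.length_pos_iff.2 hne
    obtain ⟨m, hm, hmax⟩ := exists_maxOn l hne
    refine Built.mono (S := K * l.length + 1) ?_ (by nlinarith)
    refine (hXY l c₀ k htbl hv hk hne hnd hP hn).bind fun c₁ a₁ h01 hv1 ha1 hR1 => ?_
    have l01 := h01.length_le
    refine .emit (nd := .cmp 2 (m 2) a₁ k) hv1 ⟨isCoordOf (hP m hm) 2, by omega, by omega⟩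
      fun code a hc ha q s => ?_
    by_cases hmq : m 2 ≤ q 2
    · obtain ⟨t, s', h, hE, ht⟩ := hR1 code hc q s fun p hp => (hmax p hp).trans hmq
      exact ⟨t + 1, s', .head (.cmpYes ha hmq) h, hE, by omega⟩
    · refine ⟨1, s, .head (.cmpNo ha hmq) .refl, hnone _ _ _ fun p hp h' => hmq ?_, by omega⟩
      -- At height 0 the list has at most `lam ^ 0 = 1` points, so the one comparison decides.
      obtain rfl : p = m := by
        have h1 : l.length = 1 := by simp at hl; omega
        obtain ⟨x, rfl⟩ := List.length_eq_one_iff.1 h1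
        simp_all
      exact h' 2
  | succ d ih =>
    -- The children of a node form a chain of at most `r` groups of up to `lam ^ d` points. A group
    -- `H` entirely below `q` is answered by its two-dimensional structure, and the chain goes on;
    -- the first other group is entered recursively and ends the chain.
    have key : ∀ r (l : List Point3) (c₀ : List Node), tbl <+: c₀ → Valid P n c₀ →
        k < c₀.length → l.Nodup → (∀ p ∈ l, p ∈ P) → l.length ≤ n →
        (l.Pairwise fun a b => a 2 ≤ b 2) → l.length ≤ r * lam ^ d →
        Built P n ((K + 1) * (d + 2) * l.length) (fun code a => ∀ q s, ∃ t s',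
          Reach code q t a s k s' ∧ E q l s s' ∧
          t ≤ (A + 1) * (r + (lam * d + 1)) + D * (domList q l).length) c₀ := by
      intro r
      induction r with
      | zero =>
        intro l c₀ _ hv hk _ _ _ _ hl
        obtain rfl : l = [] := by simpa using hl
        exact .pure hv hk fun code _ q s => ⟨0, s, .refl, hnone _ _ _ (by simp), by omega⟩
      | succ r ihr =>
        intro l c₀ htbl hv hk hnd hP hn hs hl
        by_cases hne : l = []
        · subst hne
          exact .pure hv hk fun code _ q s => ⟨0, s, .refl, hnone _ _ _ (by simp), by omega⟩
        have hpos := List.length_pos_iff.2 hne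
        obtain ⟨H, R, rfl, hHne, hH, hR⟩ : ∃ H R, l = H ++ R ∧ H ≠ [] ∧ H.length ≤ lam ^ d ∧
            R.length ≤ r * lam ^ d := by
          have : 0 < lam ^ d := by positivity
          refine ⟨l.take (lam ^ d), l.drop (lam ^ d), by simp, ?_, by simp, ?_⟩
          · rw [← List.length_pos_iff, List.length_take]; omega
          · rw [List.length_drop, Nat.sub_le_iff_le_add]
            rwa [Nat.succ_mul] at hl
        have hHpos := List.length_pos_iff.2 hHne
        rw [List.length_append] at hn hl ⊢
        rw [List.pairwise_append] at hs
        rw [List.nodup_append] at hnd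
        simp only [List.mem_append] at hP
        obtain ⟨m, hm, hmax⟩ := exists_maxOn H hHne
        -- The comparison record is charged to the nonempty group `H`, so a level costs `K + 1`
        -- records per point.
        refine Built.mono (S := (K + 1) * (d + 2) * R.length + (K * H.length +
          ((K + 1) * (d + 1) * H.length + 1))) ?_ (by nlinarith)
        refine (ihr R c₀ htbl hv hk hnd.2.1 (fun p hp => hP p (.inr hp)) (by omega) hs.2.1 hR).bind
          fun c₁ a₁ h01 hv1 ha1 hR1 => ?_
        refine (hXY H c₁ a₁ (htbl.trans h01) hv1 ha1 hHne hnd.1 (fun p hp => hP p (.inl hp))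
          (by omega)).bind fun c₂ a₂ h12 hv2 ha2 hR2 => ?_
        have l01 := h01.length_le
        have l12 := h12.length_le
        refine (ih H c₂ k (htbl.trans (h01.trans h12)) hv2 (by omega) hnd.1
          (fun p hp => hP p (.inl hp)) (by omega) hs.1 hH).bind fun c₃ a₃ h23 hv3 ha3 hR3 => ?_
        have l23 := h23.length_le
        refine .emit (nd := .cmp 2 (m 2) a₂ a₃) hv3
          ⟨isCoordOf (hP m (.inl hm)) 2, by omega, by omega⟩ fun code a hc ha q s => ?_
        rw [domList_append, List.length_append, Nat.mul_add D]
        have hmul : (A + 1) * (r + 1 + (lam * d + 1)) = (A + 1) * (r + (lam * d + 1)) + A + 1 := by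
          ring
        by_cases hmq : m 2 ≤ q 2
        · obtain ⟨t, s', h, hE, ht⟩ := hR2 code (h23.trans hc) q s fun p hp =>
            (hmax p hp).trans hmq
          obtain ⟨t', s'', h', hE', ht'⟩ := hR1 code (h12.trans (h23.trans hc)) q s'
          exact ⟨t + t' + 1, s'', .head (.cmpYes ha hmq) (h.trans h'), happ _ _ _ _ _ _ hE hE',
            by omega⟩
        · obtain ⟨t, s', h, hE, ht⟩ := hR3 code hc q s
          -- All of `R` lies at or above `m` in the third coordinate, hence above `q`, and
          -- contributes nothing.
          refine ⟨t + 1, s', .head (.cmpNo ha hmq) h, happ _ _ _ _ _ _ hE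
            (hnone _ _ _ fun p hp h' => hmq ((hs.2.2 m hm p hp).trans (h' 2))), ?_⟩
          have : (A + 1) * (lam * d + 1) ≤ (A + 1) * (r + (lam * d + 1)) :=
            Nat.mul_le_mul_left _ (by omega)
          omega
    refine ((key lam l c₀ htbl hv hk hnd hP hn hs (by rwa [pow_succ'] at hl)).imp
      fun code a _ hR q s => ?_)
    obtain ⟨t, s', h, hE, ht⟩ := hR q s
    exact ⟨t, s', h, hE, ht.trans (le_of_eq (by ring))⟩

/-- The data structure: code with entry points for counting and reporting. -/
theorem exists_code {n lam : ℕ} {P : Finset Point3} (hlam : 2 ≤ lam) (hn : lam ≤ n)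
    (hP : P.card = n) : ∃ (code : List Node) (a b j : ℕ), Valid P n code ∧ a < code.length ∧
      b < code.length ∧ code[j]? = some .halt ∧ code.length ≤ 42 * Nat.clog lam n * n ∧
      (∀ q, ∃ t s, Reach code q t a ⟨0, 0, []⟩ j s ∧ s.acc = (domList q P.toList).length ∧
        t ≤ (6 * Nat.log 2 n + 9) * (lam * Nat.clog lam n + 1)) ∧
      ∀ q, ∃ t s, Reach code q t b ⟨0, 0, []⟩ j s ∧ s.out.Perm (domList q P.toList) ∧
        t ≤ (6 * Nat.log 2 n + 9) * (lam * Nat.clog lam n + 1) +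
          6 * (domList q P.toList).length := by
  set B := Nat.log 2 n with hBdef
  set d := Nat.clog lam n with hd
  have hB : 0 < B := Nat.log_pos (by omega) (by omega)
  have hBn : 2 ^ B ≤ n := Nat.pow_log_le_self 2 (by omega)
  have hnB : n < 2 ^ (B + 1) := Nat.lt_pow_succ_log_self (by omega) n
  have hdpos : 0 < d := Nat.clog_pos (by omega) (by omega)
  have hnd : n ≤ lam ^ d := Nat.le_pow_clog (by omega) n
  obtain ⟨l, hperm, hsort⟩ := exists_sorted 2 P.toList
  have hlen : l.length = n := by rw [hperm.length_eq, Finset.length_toList, hP]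
  have hnodup : l.Nodup := hperm.nodup_iff.2 P.nodup_toList
  have hlP : ∀ p ∈ l, p ∈ P := fun p hp => by simpa using hperm.subset hp
  have hdom : ∀ q, (domList q l).Perm (domList q P.toList) := fun q => hperm.filter _
  -- The table comes first because it is addressed by value; the `halt` record at `2 ^ B` is where
  -- both trees continue at the end.
  set c₀ := popTable B ++ [Node.halt] with hc₀
  have htbl₀ : popTable B <+: c₀ := List.prefix_append _ _
  have hv₀ : Valid P n c₀ := (valid_popTable hBn).append (by simp [Node.Ok])
  have hlen₀ : c₀.length = 2 ^ B + 1 := by simp [hc₀, popTable]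
  have hhalt : ∀ code, c₀ <+: code → code[2 ^ B]? = some Node.halt := by
    rintro _ ⟨t, rfl⟩
    rw [List.getElem?_append_left (by omega), hc₀, List.getElem?_append_right (by simp [popTable])]
    simp [popTable]
  -- Both trees use the same constants: 9 records per point suffice for counting, and `6 * (B + 1) +
  -- 2` is the fixed cost of reporting.
  have hcount := built_tree (P := P) (n := n) (K := 9) (A := 6 * B + 8) (D := 0) (lam := lam)
    (tbl := popTable B) (E := fun q l s s' => s'.acc = s.acc + (domList q l).length) (by omega)
    (fun q l s h => by simp [domList_eq_nil h])
    (fun q l l' s s' s'' h h' => by rw [h', h, domList_append, List.length_append, Nat.add_assoc])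
    (fun l c₀ k htbl hv hk hne hnd hP hn =>
      (built_countXY hB hBn hnB l c₀ k htbl hv hk hne hnd hP hn).imp fun code a _ hR q s hz => by
        obtain ⟨t, p', ht, h⟩ := hR q s
        exact ⟨t, _, h, by rw [domXY_eq_domList hz], by omega⟩)
    d l c₀ (2 ^ B) htbl₀ hv₀ (by omega) hnodup hlP hlen.le hsort (by omega)
  obtain ⟨c₁, a, h01, hl1, hv1, ha, hR1⟩ := hcount
  have l01 := h01.length_le
  have hreport := built_tree (P := P) (n := n) (K := 9) (A := 6 * B + 8) (D := 6) (lam := lam)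
    (tbl := popTable B) (E := fun q l s s' => ∃ o, s'.out = s.out ++ o ∧ o.Perm (domList q l))
    (by omega)
    (fun q l s h => ⟨[], by simp [domList_eq_nil h]⟩)
    (fun q l l' s s' s'' ⟨o, h, hp⟩ ⟨o', h', hp'⟩ => ⟨o ++ o', by rw [h', h, List.append_assoc],
      by rw [domList_append]; exact hp.append hp'⟩)
    (fun l c₀ k htbl hv hk hne hnd hP hn => by
      obtain ⟨s, hs, hsort⟩ := exists_sorted 0 l
      have hlen := hs.length_eq
      refine ((built_reportXY (B + 1) s c₀ k hv hk hsort (fun p hp => hP p (hs.subset hp))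
        (by omega)).mono (by omega)).imp fun code a _ hR q st hz => ?_
      obtain ⟨t, o, h, hp, ht, -⟩ := hR q st
      have hp' : o.Perm (domList q l) := by
        rw [← domXY_eq_domList hz]
        exact hp.trans (hs.filter _)
      exact ⟨t, _, h, ⟨o, rfl, hp'⟩, by rw [← hp'.length_eq]; omega⟩)
    d l c₁ (2 ^ B) (htbl₀.trans h01) hv1 (by omega) hnodup hlP hlen.le hsort (by omega)
  obtain ⟨c₂, b, h12, hl2, hv2, hb, hR2⟩ := hreport
  have l12 := h12.length_le
  refine ⟨c₂, a, b, 2 ^ B, hv2, by omega, hb, hhalt _ (h01.trans h12), ?_, fun q => ?_, fun q => ?_⟩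
  · rw [hlen] at hl1 hl2
    have : (9 + 1) * (d + 1) * n + (9 + 1) * (d + 1) * n + (n + 1) ≤ 42 * d * n := by nlinarith
    omega
  · obtain ⟨t, s, h, hE, ht⟩ := hR1 c₂ h12 q ⟨0, 0, []⟩
    exact ⟨t, s, h, by simpa [(hdom q).length_eq] using hE, by simpa using ht⟩
  · obtain ⟨t, s, h, ⟨o, ho, hp⟩, ht⟩ := hR2 c₂ List.prefix_rfl q ⟨0, 0, []⟩
    refine ⟨t, s, h, ?_, by rwa [(hdom q).length_eq] at ht⟩
    rw [ho]
    exact hp.trans (hdom q)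

theorem length_domList_toList (P : Finset Point3) (q : Point3) :
    (domList q P.toList).length = (dominated P q).card := by
  classical
  rw [domList, dominated, ← List.toFinset_card_of_nodup (P.nodup_toList.filter _)]
  congr 1
  ext p
  simp

theorem mem_domList_toList {P : Finset Point3} {q p : Point3} :
    p ∈ domList q P.toList ↔ p ∈ dominated P q := by
  simp [domList, dominated]

end WordRAM

/-! ### Real logarithms and the word size -/

open WordRAM in
theorem mainTheorem9 (ε : ℝ) (hε : 0 < ε) :
    ∃ (C κ : ℝ) (countProg reportProg : WordRAM.Program),
      ∀ (n lam w : ℕ) (P : Finset WordRAM.Point3),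
        2 ≤ lam → lam ≤ n → P.card = n → κ * Real.logb 2 n ≤ w →
        ∃ mem : List WordRAM.Cell,
          WordRAM.IsMemoryFor w P mem ∧
          (mem.length : ℝ) ≤ C * (n * Real.logb lam n) ∧
          ∀ q : WordRAM.Point3,
            WordRAM.HaltsWithin w countProg mem q
              (C * (lam * Real.logb 2 n * Real.logb lam n))
              (fun v _ => v = (WordRAM.dominated P q).card) ∧
            WordRAM.HaltsWithin w reportProg mem q
              (C * (lam * Real.logb 2 n * Real.logb lam n +
                (WordRAM.dominated P q).card * (Real.logb 2 n) ^ ε))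
              (fun _ out => out.Nodup ∧ ∀ p, p ∈ out ↔ p ∈ WordRAM.dominated P q) := by
  -- The time constant 60 * 45 + 21 is below 3000. With word size at least `11 * lg n`, `2 ^ w ≥ n ^
  -- 11 ≥ 2 ^ 9 * n ^ 2`, which exceeds every address.
  refine ⟨3000, 11, interp 0, interp 1, fun n lam w P hlam hn hP hw => ?_⟩
  have hn2 : 2 ≤ n := hlam.trans hn
  have hnR : (2 : ℝ) ≤ n := by exact_mod_cast hn2
  have hlamR : (2 : ℝ) ≤ lam := by exact_mod_cast hlam
  have hlamn : (lam : ℝ) ≤ n := by exact_mod_cast hn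
  set g := Real.logb 2 n with hg
  set h := Real.logb lam n with hh
  have hg1 : 1 ≤ g := by
    rw [hg, Real.le_logb_iff_rpow_le (by norm_num) (by linarith)]
    simpa using hnR
  have hh1 : 1 ≤ h := by
    rw [hh, Real.le_logb_iff_rpow_le (by linarith) (by linarith)]
    simpa using hlamn
  have hB : (Nat.log 2 n : ℝ) ≤ g := by
    rw [hg, Real.le_logb_iff_rpow_le (by norm_num) (by linarith), Real.rpow_natCast]
    exact_mod_cast Nat.pow_log_le_self 2 (by omega)
  -- Rounding up adds at most 1, and `1 ≤ h` because `lam ≤ n`.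
  have hd : (Nat.clog lam n : ℝ) ≤ 2 * h := by
    have h0 : 0 < Nat.clog lam n := Nat.clog_pos (by omega) (by omega)
    have h1 : ((Nat.clog lam n - 1 : ℕ) : ℝ) ≤ h := by
      rw [hh, Real.le_logb_iff_rpow_le (by linarith) (by linarith), Real.rpow_natCast]
      exact_mod_cast (Nat.pow_pred_clog_lt_self (by omega) (by omega)).le
    rw [Nat.cast_sub h0, Nat.cast_one] at h1
    linarith
  have hpow : n ^ 11 ≤ 2 ^ w := by
    have h1 : (n : ℝ) ^ 11 ≤ 2 ^ w := by
      calc (n : ℝ) ^ 11 = (2 : ℝ) ^ (11 * g) := by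
            rw [mul_comm, Real.rpow_mul (by norm_num), hg, Real.rpow_logb (by norm_num)
              (by norm_num) (by linarith)]
            norm_cast
        _ ≤ (2 : ℝ) ^ (w : ℝ) := Real.rpow_le_rpow_of_exponent_le (by norm_num) hw
        _ = 2 ^ w := Real.rpow_natCast _ _
    exact_mod_cast h1
  obtain ⟨code, a, b, j, hv, ha, hb, hj, hlen, hcount, hreport⟩ := exists_code hlam hn hP
  have hdn : Nat.clog lam n ≤ n := by
    refine Nat.clog_le_of_le_pow (n.lt_two_pow_self.le.trans (Nat.pow_le_pow_left hlam n))
  have hwbig : 6 * code.length + n + 16 ≤ 2 ^ w := by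
    have h1 : 42 * Nat.clog lam n * n ≤ 42 * n * n := by gcongr
    have h2 : 2 ^ 9 * (n * n) ≤ n ^ 9 * (n * n) := by gcongr
    have h3 : n ^ 9 * (n * n) = n ^ 11 := by ring
    nlinarith
  have htime : (((6 * Nat.log 2 n + 9) * (lam * Nat.clog lam n + 1) : ℕ) : ℝ) ≤
      45 * (lam * g * h) := by
    push_cast
    have h1 : (6 * (Nat.log 2 n : ℝ) + 9) ≤ 15 * g := by linarith
    have h2 : (lam * Nat.clog lam n + 1 : ℝ) ≤ 3 * (lam * h) := by nlinarith
    calc _ ≤ (15 * g) * (3 * (lam * h)) := by gcongr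
      _ = _ := by ring
  have hone : 1 ≤ lam * g * h := by
    have : 1 ≤ (lam : ℝ) * g := by nlinarith
    nlinarith
  refine ⟨memOf code a b, isMemoryFor_memOf hv ha hb (by omega), ?_, fun q => ⟨?_, ?_⟩⟩
  · rw [length_memOf]
    have h1 : ((code.length : ℕ) : ℝ) ≤ 42 * Nat.clog lam n * n := by exact_mod_cast hlen
    have h2 : (42 * Nat.clog lam n * n : ℝ) ≤ 42 * (2 * h) * n := by gcongr
    push_cast
    nlinarith
  · obtain ⟨t, s, hr, hacc, ht⟩ := hcount q
    have htR : (t : ℝ) ≤ 45 * (lam * g * h) := le_trans (by exact_mod_cast ht) htime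
    refine interp_haltsWithin hwbig hv (by rfl) (by omega) hr hj ?_ ?_
    · push_cast; linarith
    · rw [hacc, length_domList_toList]
      -- The count is at most `n < 2 ^ w`, so the reduced accumulator is exact.
      refine Nat.mod_eq_of_lt ?_
      have : (dominated P q).card ≤ P.card := by
        rw [← length_domList_toList, ← Finset.length_toList]
        exact List.length_filter_le ..
      omega
  · obtain ⟨t, s, hr, hperm, ht⟩ := hreport q
    rw [length_domList_toList] at ht
    set k := (dominated P q).card with hk
    have htR : (t : ℝ) ≤ 45 * (lam * g * h) + 6 * k := by
      refine le_trans (b := ((_ : ℕ) : ℝ)) (by exact_mod_cast ht) ?_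
      push_cast at htime ⊢
      linarith
    -- The only place where `ε` matters: the constant cost per reported point is weakened to the
    -- stated one.
    have hgε : (k : ℝ) ≤ k * g ^ ε :=
      le_mul_of_one_le_right (Nat.cast_nonneg _) (Real.one_le_rpow hg1 hε.le)
    refine interp_haltsWithin hwbig hv (by rfl) (by omega) hr hj ?_ ⟨?_, fun p => ?_⟩
    · push_cast
      have : (0 : ℝ) ≤ k := Nat.cast_nonneg _
      linarith
    · exact hperm.nodup_iff.2 (P.nodup_toList.filter _)
    · rw [hperm.mem_iff, mem_domList_toList]
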